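/- There are absolute constants $c_0,A>0$ and, for all $K>2$ and $N\ge 1$, a number $C>0$ depending only on $K$, $N$, $c_Q$ and the constants $\ell_{a_j},C_{a_j},L_{f\circ a_K\circ\dots\circ a_{i+1}},C_{f\circ a_K\circ\dots\circ a_{i+1}}$ below, such that the following holds. **Model.** A network is split over a pipeline of $K$ machines. Machine $1$ computes $a_1(\xi,x^{(1)})$ from a sample $\xi$ (one of $N$ samples), machine $j\ge 2$ computes $a_j(u,x^{(j)})$ from the activation $u$ that it receives, and a loss $F$ is applied to the output of machine $K$; activations and parameters $x^{(j)}$ are vectors in Euclidean spaces. Write $x=(x^{(1)},\dots,x^{(K)})$, let $f_\xi(x)$ be the loss of the complete model on $\xi$, $f(x)=\frac1N\sum_\xi f_\xi(x)$, $g_\xi=\nabla f_\xi$, $f^*=\inf f$, which is assumed to be finite, and let $f\circ a_K\circ\dots\circ a_{i+1}$ be the loss as a function of the activation entering machine $i+1$ and of $x^{(i+1)},\dots,x^{(K)}$. **Assumptions.** $f$ is differentiable with $L_f$-Lipschitz gradient. For $1\le i\le K-1$, $f\circ a_K\circ\dots\circ a_{i+1}$ is differentiable, its gradient is $L_{f\circ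 a_K\circ\dots\circ a_{i+1}}$-Lipschitz and bounded in norm by $C_{f\circ a_K\circ\dots\circ a_{i+1}}$. For $1\le j\le K$, $a_j$ is differentiable and $\ell_{a_j}$-Lipschitz with derivative bounded by $C_{a_j}$ (jointly in its two arguments for $j\ge2$; in $x^{(1)}$, for every $\xi$, for $j=1$). For $\xi$ uniform on the $N$ samples, $\mathbb E_\xi\|g_\xi(x)-\nabla f(x)\|^2\le\sigma^2$ for all $x$ (and $\mathbb E_\xi g_\xi(x)=\nabla f(x)$). The quantizer $Q$ is random, with fresh independent randomness at every use, and there is $0\le c_Q<\sqrt{1/2}$ with $\mathbb E\,Q(v)=v$ and $\mathbb E\|v-Q(v)\|^2\le c_Q^2\|v\|^2$ for all $v$. **Algorithm.** Start from any $x_1$. At iteration $t$ draw $\xi_t$ uniformly from the $N$ samples, independently of the past. For $i=1,\dots,K-1$ in turn, machine $i$ computes $u_i=a_i(m_{i-1}(\xi_t),x_t^{(i)})$ ($u_1=a_1(\xi_t,x_t^{(1)})$ for $i=1$); the buffered message is set to $m_i(\xi_t)=u_i$ if $\xi_t$ was not drawn before, and otherwise is updated by $m_i(\xi_t)\leftarrow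 m_i(\xi_t)+Q\big(u_i-m_i(\xi_t)\big)$. Then, with learning rate $\gamma$, $$x_{t+1}^{(K)}=x_t^{(K)}-\gamma\,\nabla_{x^{(K)}}(f\circ a_K)\big|_{(m_{K-1}(\xi_t),x_t^{(K)})},$$ $$x_{t+1}^{(i)}=x_t^{(i)}-\gamma\, Q\Big(\nabla_{a_i}(f\circ a_K\circ\dots\circ a_{i+1})\big|_{(m_i(\xi_t),x_t^{(i+1)},\dots,x_t^{(K)})}\Big)\cdot\nabla_{x^{(i)}}a_i\big|_{(m_{i-1}(\xi_t),x_t^{(i)})},\qquad 1\le i\le K-1,$$ where for $i=1$ the last factor is $\nabla_{x^{(1)}}a_1(\xi_t,\cdot)$ at $x_t^{(1)}$. **Conclusion.** Let $\tilde C=\sqrt{\sum_{i=1}^{K-1}C_{a_i}^2C_{f\circ a_K\circ\dots\circ a_{i+1}}^2}$. For every $T\ge1$, with $\gamma=\dfrac{c_0}{(C+L_f)\sqrt T}$, $$\frac1T\sum_{t=1}^T\mathbb E\|\nabla f(x_t)\|^2\le A\left(\frac{(C+L_f)(f(x_1)-f^*)}{\sqrt T}+\frac{\sigma^2+(c_Q\tilde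 C)^2}{\sqrt T}\right).$$ -/

import Mathlib

open MeasureTheory ProbabilityTheory
open scoped NNReal

noncomputable section

/-- A pipeline of `K = n + 1` machines `a_1, …, a_K`, and hence `n = K - 1` links between consecutive
machines, trained on `N` samples.  Machines are indexed by `Fin (n + 1)`; link `i : Fin n` goes
from machine `i.castSucc` to machine `i.succ`.  Machine `j` holds a parameter block in
`ℝ ^ parDim j` and outputs an activation in `ℝ ^ actDim j`. -/
structure Pipeline (n N : ℕ) where
  actDim : Fin (n + 1) → ℕ
  parDim : Fin (n + 1) → ℕ
  /-- the first machine `a_1(ξ, x⁽¹⁾)` -/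
  first : Fin N → EuclideanSpace ℝ (Fin (parDim 0)) → EuclideanSpace ℝ (Fin (actDim 0))
  /-- the machine at the receiving end of link `i`, a function of the incoming activation and of
  its own parameter block, jointly -/
  next : ∀ i : Fin n,
    WithLp 2 (EuclideanSpace ℝ (Fin (actDim i.castSucc)) × EuclideanSpace ℝ (Fin (parDim i.succ))) →
      EuclideanSpace ℝ (Fin (actDim i.succ))
  /-- the loss function applied to the output of the last machine -/
  loss : EuclideanSpace ℝ (Fin (actDim (Fin.last n))) → ℝ

namespace Pipeline

variable {n N : ℕ} (P : Pipeline n N)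

/-- Activation space of machine `j`. -/
abbrev Act (j : Fin (n + 1)) : Type := EuclideanSpace ℝ (Fin (P.actDim j))

/-- Parameter space of machine `j`. -/
abbrev Par (j : Fin (n + 1)) : Type := EuclideanSpace ℝ (Fin (P.parDim j))

/-- The space of the complete model `x = (x⁽¹⁾, …, x⁽ᴷ⁾)`, with the Euclidean norm. -/
abbrev Params : Type := PiLp 2 P.Par

/-- The exact activation of machine `j` on sample `ξ`. -/
def activation (ξ : Fin N) (x : P.Params) (j : Fin (n + 1)) : P.Act j :=
  Fin.induction (motive := fun j => P.Act j) (P.first ξ (x 0))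
    (fun i u => P.next i (WithLp.toLp 2 (u, x i.succ))) j

/-- The loss of the complete model on sample `ξ`. -/
def sampleLoss (ξ : Fin N) (x : P.Params) : ℝ := P.loss (P.activation ξ x (Fin.last n))

/-- The objective: the expected loss under the uniform distribution on the `N` samples. -/
def objective (x : P.Params) : ℝ := (∑ ξ : Fin N, P.sampleLoss ξ x) / N

/-- `P.tail j v x` is the loss obtained by feeding `v` as the output of machine `j` to the
machines after `j`; it only uses the parameter blocks of the machines after `j`. -/
def tail (j : Fin (n + 1)) : P.Act j → P.Params → ℝ :=
  Fin.reverseInduction (motive := fun j => P.Act j → P.Params → ℝ)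
    (fun v _ => P.loss v)
    (fun i F v x => F (P.next i (WithLp.toLp 2 (v, x i.succ))) x) j

/-- The function `f ∘ a_K ∘ ⋯ ∘ a_{i+1}` of the activation entering the machine after link `i` and
of the parameters of the machines after link `i`.  It is written as a function on the whole
parameter space which does not depend on the remaining blocks; this changes neither the norm nor
the Lipschitz constant of its gradient. -/
def tailJoint (i : Fin n) (z : WithLp 2 (P.Act i.castSucc × P.Params)) : ℝ :=
  P.tail i.castSucc z.fst z.snd

end Pipeline

/-- The Lipschitz and boundedness constants of a pipeline with `n` links: `lip j` and `bound j`
for machine `j`, and `tailLip i` and `tailBound i` for the gradient of the composition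
`f ∘ a_K ∘ ⋯ ∘ a_{i+1}` of everything after link `i`. -/
structure PipelineConstants (n : ℕ) where
  lip : Fin (n + 1) → ℝ≥0
  bound : Fin (n + 1) → ℝ≥0
  tailLip : Fin n → ℝ≥0
  tailBound : Fin n → ℝ≥0

/-- `C̃ ^ 2 = ∑_{i = 1}^{K - 1} C_{a_i} ^ 2 C_{f ∘ a_K ∘ ⋯ ∘ a_{i+1}} ^ 2`. -/
def PipelineConstants.cTildeSq {n : ℕ} (c : PipelineConstants n) : ℝ :=
  ∑ i : Fin n, (c.bound i.castSucc : ℝ) ^ 2 * (c.tailBound i : ℝ) ^ 2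

/-- `F` is differentiable with `L`-Lipschitz gradient. -/
def HasLipschitzGradient {E : Type*} [NormedAddCommGroup E] [InnerProductSpace ℝ E]
    [CompleteSpace E] (L : ℝ≥0) (F : E → ℝ) : Prop :=
  Differentiable ℝ F ∧ LipschitzWith L (gradient F)

/-- `g` is `ℓ`-Lipschitz and differentiable, with derivative bounded by `B`. -/
def LipschitzBoundedDeriv {E F : Type*} [NormedAddCommGroup E] [NormedSpace ℝ E]
    [NormedAddCommGroup F] [NormedSpace ℝ F] (l B : ℝ≥0) (g : E → F) : Prop :=
  LipschitzWith l g ∧ Differentiable ℝ g ∧ ∀ z, ‖fderiv ℝ g z‖ ≤ B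

/-- The generalized Lipschitz assumptions. -/
structure Pipeline.LipschitzAssumptions {n N : ℕ} (P : Pipeline n N) (Lf : ℝ≥0)
    (c : PipelineConstants n) : Prop where
  objective : HasLipschitzGradient Lf P.objective
  tail_lip : ∀ i, HasLipschitzGradient (c.tailLip i) (P.tailJoint i)
  tail_bound : ∀ i z, ‖gradient (P.tailJoint i) z‖ ≤ c.tailBound i
  first : ∀ ξ, LipschitzBoundedDeriv (c.lip 0) (c.bound 0) (P.first ξ)
  next : ∀ i : Fin n, LipschitzBoundedDeriv (c.lip i.succ) (c.bound i.succ) (P.next i)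

/-- The stochastic gradient `∇ (sampleLoss ξ)`, for `ξ` uniform, has variance at most `σ ^ 2`
around the gradient of the objective. -/
def Pipeline.BoundedVariance {n N : ℕ} (P : Pipeline n N) (σ : ℝ) : Prop :=
  ∀ x, (∑ ξ : Fin N, ‖gradient (P.sampleLoss ξ) x - gradient P.objective x‖ ^ 2) / N ≤ σ ^ 2

/-- A randomized map `v ↦ q v s`, with random seed `s` of law `ν`, is an unbiased quantizer with
relative mean square error at most `c ^ 2`. -/
structure IsUnbiasedQuantizer {E S : Type*} [NormedAddCommGroup E] [NormedSpace ℝ E]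
    [MeasurableSpace E] [MeasurableSpace S] (ν : Measure S) (q : E → S → E) (c : ℝ) : Prop where
  measurable : Measurable (Function.uncurry q)
  integrable : ∀ v, Integrable (q v) ν
  unbiased : ∀ v, ∫ s, q v s ∂ν = v
  integrable_sq : ∀ v, Integrable (fun s => ‖v - q v s‖ ^ 2) ν
  error_le : ∀ v, ∫ s, ‖v - q v s‖ ^ 2 ∂ν ≤ c ^ 2 * ‖v‖ ^ 2

namespace Pipeline

variable {n N : ℕ} (P : Pipeline n N) {S : Type*}

/-- The messages on all links. -/
abbrev Messages : Type := ∀ i : Fin n, P.Act i.castSucc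

/-- The state of training: the model, the set of samples seen so far (as a Boolean function),
and for every sample the buffered message on every link. -/
structure State where
  model : P.Params
  seen : Fin N → Bool
  buffer : Fin N → P.Messages

/-- The state before the first update. -/
def initState (x₁ : P.Params) : P.State := ⟨x₁, fun _ => false, fun _ _ => 0⟩

/-- The quantizers, one for every link (used for both the activations and the gradients). -/
abbrev Quantizers (S : Type*) : Type _ := ∀ i : Fin n, P.Act i.castSucc → S → P.Act i.castSucc

/-- The randomness of one iteration: the sample, and on every link a seed for the quantization
of the activation and a seed for the quantization of the gradient. -/
abbrev Draw (n N : ℕ) (S : Type*) : Type _ := Fin N × (Fin n → S) × (Fin n → S)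

variable (q : P.Quantizers S)

/-- The new message on link `i` when the sending machine has computed the activation `v`:
full precision on the first visit of the sample, the old message plus the quantized change
afterwards. -/
def send (st : P.State) (d : Draw n N S) (i : Fin n) (v : P.Act i.castSucc) : P.Act i.castSucc :=
  if st.seen d.1 then
    st.buffer d.1 i + q i (v - st.buffer d.1 i) (d.2.1 i)
  else v

/-- The activation computed by machine `j` from the message that it receives. -/
def localActivation (st : P.State) (d : Draw n N S) (j : Fin (n + 1)) : P.Act j :=
  Fin.induction (motive := fun j => P.Act j) (P.first d.1 (st.model 0))
    (fun i u => P.next i (WithLp.toLp 2 (P.send q st d i u, st.model i.succ))) j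

/-- The messages of the current iteration. -/
def messages (st : P.State) (d : Draw n N S) : P.Messages :=
  fun i => P.send q st d i (P.localActivation q st d i.castSucc)

/-- Machine `j` as a function of its own parameters, with the received message as input. -/
def machine (ξ : Fin N) (m : P.Messages) (j : Fin (n + 1)) : P.Par j → P.Act j :=
  Fin.cases (motive := fun j => P.Par j → P.Act j) (P.first ξ)
    (fun i y => P.next i (WithLp.toLp 2 (m i, y))) j

/-- The block of the update direction that belongs to machine `j`.  The last machine uses the
gradient of the loss in its own parameters; a machine sending on link `i` multiplies the quantized
gradient with respect to its output, taken at the current message, by its own derivative. -/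
def direction (st : P.State) (d : Draw n N S) (m : P.Messages) (j : Fin (n + 1)) : P.Par j :=
  Fin.lastCases (motive := fun j => P.Par j)
    (gradient (fun y => P.loss (P.machine d.1 m (Fin.last n) y)) (st.model (Fin.last n)))
    (fun i =>
      (fderiv ℝ (P.machine d.1 m i.castSucc) (st.model i.castSucc)).adjoint
        (q i (gradient (fun v => P.tail i.castSucc v st.model) (m i)) (d.2.2 i))) j

/-- One iteration with learning rate `γ`. -/
def step (γ : ℝ) (st : P.State) (d : Draw n N S) : P.State where
  model := st.model - γ • WithLp.toLp 2 (P.direction q st d (P.messages q st d))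
  seen := Function.update st.seen d.1 true
  buffer := Function.update st.buffer d.1 (P.messages q st d)

/-- The state after `t` iterations from `x₁` along the sequence of draws `D`. -/
def run (γ : ℝ) (x₁ : P.Params) (D : ℕ → Draw n N S) : ℕ → P.State
  | 0 => P.initState x₁
  | t + 1 => P.step q γ (run γ x₁ D t) (D t)

/-- The law of a draw: a uniform sample and independent seeds of law `ν`. -/
def drawLaw [MeasurableSpace S] (n N : ℕ) (ν : Measure S) : Measure (Draw n N S) :=
  (uniformOn (Set.univ : Set (Fin N))).prod
    ((Measure.pi fun _ : Fin n => ν).prod (Measure.pi fun _ : Fin n => ν))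

end Pipeline

end

/-! Since `f` has Lipschitz gradient, SGD would converge at rate `1/√T` if every update were an
unbiased gradient of bounded variance. Here the update is `∇f_ξ + bias + noise`. The noise comes
from quantizing the backward gradients: given the sample and the activation seeds it has mean zero,
and its second moment is at most `c_Q² C̃²`, so it acts like extra variance (`meanLE_inner_noise`,
`meanLE_noise`). The bias comes from messages that differ from the exact activations; its square is
at most a constant times the squared message errors (`norm_bias_sq_le`). It is not centred, so it
must be paid for by showing that the message errors stay small.

They do because only changes are quantized. If `m` is the buffer, `u` the computed activation and
`a` the exact one, the new error is `(Q(u - m) - (u - m)) + (u - a)`. The first term has mean square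
at most `c_Q² ‖u - m‖²` with `c_Q² ≤ 1/2`, so the old error `‖m - a‖²` contracts, up to a multiple
of `‖u - a‖²`, which is inherited from the previous link. Weights decaying geometrically along the
pipeline make the inherited part a small fraction of the whole, which is absorbed: a visit
multiplies the weighted error of the sample by at most `4/5` in mean (`meanLE_visitError`). A given
sample is visited with probability `1/N`, so the total error `W` shrinks by `1 - 1/(5N)` per step,
except for the motion of the exact activations, which is of order `γ² ‖update‖²`
(`totalError_step_le`).

The Lyapunov function `f(x) - f* + a γ W` combines both effects. With `a` of order `N` times the
bias constant, the contraction of `W` pays for the bias, and the motion contributes only a term of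
order `γ³ ‖update‖²` beside the usual `L_f γ² ‖update‖²`. One step then gains `γ/4 ‖∇f‖²` in mean,
up to an error of order `γ (L_f γ + R γ²)(σ² + c_Q² C̃²)` (`meanLE_lyapunov_step`). Since the draw
at time `t` is independent of the state, this telescopes along the run, and `γ` of order `1/√T`
gives the rate. -/

noncomputable section

/-! ### Upper bounds for means under product laws -/

/-- `f` is integrable with mean at most `c`. -/
def MeanLE {α : Type*} [MeasurableSpace α] (μ : Measure α) (f : α → ℝ) (c : ℝ) : Prop :=
  Integrable f μ ∧ ∫ x, f x ∂μ ≤ c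

namespace MeanLE

variable {α β : Type*} [MeasurableSpace α] [MeasurableSpace β] {μ : Measure α} {ν : Measure β}

lemma weaken {f : α → ℝ} {c d : ℝ} (h : MeanLE μ f c) (hcd : c ≤ d) : MeanLE μ f d :=
  ⟨h.1, h.2.trans hcd⟩

lemma mono {f g : α → ℝ} {c : ℝ} (hg : MeanLE μ g c) (hf : Measurable f)
    (h0 : ∀ x, 0 ≤ f x) (hfg : ∀ x, f x ≤ g x) : MeanLE μ f c := by
  have hi : Integrable f μ := hg.1.mono' hf.aestronglyMeasurable
    (Filter.Eventually.of_forall fun x => by rw [Real.norm_of_nonneg (h0 x)]; exact hfg x)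
  exact ⟨hi, (integral_mono hi hg.1 hfg).trans hg.2⟩

lemma add {f g : α → ℝ} {c d : ℝ} (hf : MeanLE μ f c) (hg : MeanLE μ g d) :
    MeanLE μ (fun x => f x + g x) (c + d) := by
  refine ⟨hf.1.add hg.1, ?_⟩
  rw [integral_add hf.1 hg.1]
  exact add_le_add hf.2 hg.2

lemma const_mul {f : α → ℝ} {c a : ℝ} (hf : MeanLE μ f c) (ha : 0 ≤ a) :
    MeanLE μ (fun x => a * f x) (a * c) := by
  refine ⟨hf.1.const_mul a, ?_⟩
  rw [integral_const_mul]
  exact mul_le_mul_of_nonneg_left hf.2 ha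

lemma const [IsProbabilityMeasure μ] (a : ℝ) : MeanLE μ (fun _ => a) a :=
  ⟨integrable_const a, by simp⟩

lemma sum {ι : Type*} (s : Finset ι) {f : ι → α → ℝ} {c : ι → ℝ}
    (h : ∀ i ∈ s, MeanLE μ (f i) (c i)) :
    MeanLE μ (fun x => ∑ i ∈ s, f i x) (∑ i ∈ s, c i) := by
  refine ⟨integrable_finsetSum s fun i hi => (h i hi).1, ?_⟩
  rw [integral_finsetSum s fun i hi => (h i hi).1]
  exact Finset.sum_le_sum fun i hi => (h i hi).2

/-- Tonelli for nonnegative functions: conditional means only need an integrable upper bound `g`,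
and joint integrability is a consequence. -/
lemma prod [SFinite μ] [SFinite ν] {f : α × β → ℝ} {g : α → ℝ} {c : ℝ} (hf : Measurable f)
    (h0 : ∀ p, 0 ≤ f p) (hfg : ∀ x, MeanLE ν (fun y => f (x, y)) (g x)) (hg : MeanLE μ g c) :
    MeanLE (μ.prod ν) f c := by
  have hm : MeanLE μ (fun x => ∫ y, f (x, y) ∂ν) c :=
    hg.mono hf.stronglyMeasurable.integral_prod_right'.measurable
      (fun x => integral_nonneg fun y => h0 _) (fun x => (hfg x).2)
  have hi : Integrable f (μ.prod ν) := by
    rw [integrable_prod_iff hf.aestronglyMeasurable]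
    refine ⟨Filter.Eventually.of_forall fun x => (hfg x).1, ?_⟩
    simpa only [Real.norm_of_nonneg (h0 _)] using hm.1
  exact ⟨hi, by rw [integral_prod _ hi]; exact hm.2⟩

end MeanLE

/-- Resampling one coordinate preserves a product law. -/
lemma measurePreserving_update {ι S : Type*} [Fintype ι] [DecidableEq ι] [MeasurableSpace S]
    (ν : Measure S) [IsProbabilityMeasure ν] (i : ι) :
    MeasurePreserving (fun p : (ι → S) × S => Function.update p.1 i p.2)
      ((Measure.pi fun _ : ι => ν).prod ν) (Measure.pi fun _ : ι => ν) := by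
  have hm : Measurable (fun p : (ι → S) × S => Function.update p.1 i p.2) := by
    refine measurable_pi_lambda _ fun j => ?_
    by_cases h : j = i
    · subst h; simpa using measurable_snd
    · simp only [Function.update_of_ne h]
      exact (measurable_pi_apply j).comp measurable_fst
  refine ⟨hm, (Measure.pi_eq fun s hs => ?_).symm⟩
  rw [Measure.map_apply hm (MeasurableSet.univ_pi hs)]
  have : (fun p : (ι → S) × S => Function.update p.1 i p.2) ⁻¹' Set.univ.pi s =
      (Set.univ.pi (Function.update s i Set.univ)) ×ˢ s i := by
    ext ⟨x, y⟩
    simp only [Set.mem_preimage, Set.mem_pi, Set.mem_univ, true_imp_iff, Set.mem_prod]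
    constructor
    · intro h
      refine ⟨fun j => ?_, by simpa using h i⟩
      by_cases hj : j = i
      · subst hj; simp
      · simpa [hj] using h j
    · rintro ⟨h, hy⟩ j
      by_cases hj : j = i
      · subst hj; simpa using hy
      · simpa [hj] using h j
  rw [this, Measure.prod_prod, Measure.pi_pi, ← Finset.mul_prod_erase _ _ (Finset.mem_univ i),
    ← Finset.mul_prod_erase (Finset.univ) (fun j => ν (s j)) (Finset.mem_univ i)]
  simp only [Function.update_self, measure_univ, one_mul]
  rw [mul_comm]
  congr 1
  refine Finset.prod_congr rfl fun j hj => ?_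
  rw [Function.update_of_ne (Finset.ne_of_mem_erase hj)]

/-- Conditioning on all coordinates but `i`: by independence, coordinate `i` may be redrawn and
averaged first. This is how one quantization seed is averaged with the other seeds fixed. -/
lemma MeanLE.of_update {ι S : Type*} [Fintype ι] [DecidableEq ι] [MeasurableSpace S]
    {ν : Measure S} [IsProbabilityMeasure ν] (i : ι) {f h : (ι → S) → ℝ} {c : ℝ}
    (hf : Measurable f) (h0 : ∀ x, 0 ≤ f x)
    (hfh : ∀ x, MeanLE ν (fun s => f (Function.update x i s)) (h x))
    (hh : MeanLE (Measure.pi fun _ : ι => ν) h c) :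
    MeanLE (Measure.pi fun _ : ι => ν) f c := by
  have hp := measurePreserving_update ν i
  have key := MeanLE.prod (hf.comp hp.measurable) (fun p => h0 _) hfh hh
  refine ⟨(hp.integrable_comp hf.aestronglyMeasurable).1 key.1, ?_⟩
  rw [← hp.map_eq, integral_map hp.measurable.aemeasurable hf.aestronglyMeasurable]
  exact key.2

lemma integral_uniformOn_univ {N : ℕ} (hN : 1 ≤ N) (f : Fin N → ℝ) :
    ∫ ξ, f ξ ∂(uniformOn (Set.univ : Set (Fin N))) = (∑ ξ, f ξ) / N := by
  have : Nonempty (Fin N) := ⟨⟨0, hN⟩⟩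
  rw [integral_fintype (Integrable.of_finite), Finset.sum_div]
  refine Finset.sum_congr rfl fun ξ _ => ?_
  rw [measureReal_def, uniformOn_univ]
  simp [div_eq_inv_mul]

lemma MeanLE.uniformOn_univ {N : ℕ} (hN : 1 ≤ N) {f : Fin N → ℝ} {c : ℝ}
    (h : (∑ ξ, f ξ) / N ≤ c) : MeanLE (uniformOn (Set.univ : Set (Fin N))) f c := by
  have : Nonempty (Fin N) := ⟨⟨0, hN⟩⟩
  exact ⟨Integrable.of_finite, by rwa [integral_uniformOn_univ hN]⟩

/-! ### Young's inequality and gradients on product spaces -/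

lemma norm_add_sq_le_young {E : Type*} [SeminormedAddCommGroup E] (a b : E) {β : ℝ} (hβ : 0 < β) :
    ‖a + b‖ ^ 2 ≤ (1 + β) * ‖a‖ ^ 2 + (1 + 1 / β) * ‖b‖ ^ 2 := by
  have h1 : ‖a + b‖ ^ 2 ≤ (‖a‖ + ‖b‖) ^ 2 := by gcongr; exact norm_add_le a b
  have h2 : (1 + β) * ‖a‖ ^ 2 + (1 + 1 / β) * ‖b‖ ^ 2 - (‖a‖ + ‖b‖) ^ 2
      = (β * ‖a‖ - ‖b‖) ^ 2 / β := by field_simp; ring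
  have h3 : 0 ≤ (β * ‖a‖ - ‖b‖) ^ 2 / β := by positivity
  linarith

lemma norm_add_sq_le_two {E : Type*} [SeminormedAddCommGroup E] (a b : E) :
    ‖a + b‖ ^ 2 ≤ 2 * ‖a‖ ^ 2 + 2 * ‖b‖ ^ 2 := by
  have := norm_add_sq_le_young a b one_pos
  linarith

section Gradient

variable {E F : Type*} [NormedAddCommGroup E] [InnerProductSpace ℝ E] [CompleteSpace E]
  [NormedAddCommGroup F] [InnerProductSpace ℝ F] [CompleteSpace F]

lemma gradient_comp {f : F → ℝ} {g : E → F} {g' : E →L[ℝ] F} {y : E} (hg : HasFDerivAt g g' y)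
    (hf : DifferentiableAt ℝ f (g y)) :
    gradient (fun z => f (g z)) y = g'.adjoint (gradient f (g y)) := by
  refine ext_inner_right ℝ fun e => ?_
  rw [inner_gradient_left, ContinuousLinearMap.adjoint_inner_left, inner_gradient_left,
    HasFDerivAt.fderiv (f := fun z => f (g z)) (hf.hasFDerivAt.comp y hg)]
  rfl

/-- The descent lemma. -/
lemma HasLipschitzGradient.le_add {L : ℝ≥0} {f : E → ℝ} (hf : HasLipschitzGradient L f)
    (x v : E) : f (x + v) ≤ f x + inner ℝ (gradient f x) v + L * ‖v‖ ^ 2 := by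
  -- On the ball of radius `‖v‖` the gradient varies by at most `L ‖v‖`. The mean value inequality
  -- then gives `L ‖v‖²` instead of the sharp `L/2 ‖v‖²`; the lost factor only affects absolute
  -- constants.
  have hb : ∀ z ∈ Metric.closedBall x ‖v‖, ‖fderiv ℝ f z - fderiv ℝ f x‖ ≤ L * ‖v‖ := by
    intro z hz
    have h1 : ‖gradient f z - gradient f x‖ ≤ L * ‖z - x‖ := hf.2.norm_sub_le z x
    have h2 : ‖fderiv ℝ f z - fderiv ℝ f x‖ = ‖gradient f z - gradient f x‖ := by
      rw [gradient, gradient, ← map_sub, LinearIsometryEquiv.norm_map]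
    rw [h2]
    refine h1.trans ?_
    gcongr
    simpa [dist_eq_norm] using hz
  have := (convex_closedBall x ‖v‖).norm_image_sub_le_of_norm_fderiv_le'
    (fun z _ => hf.1 z) hb (Metric.mem_closedBall_self (norm_nonneg v))
    (show x + v ∈ Metric.closedBall x ‖v‖ by simp)
  rw [add_sub_cancel_left, ← inner_gradient_left] at this
  have := (le_abs_self _).trans this
  nlinarith

end Gradient

section Gradient

variable {E F : Type*} [NormedAddCommGroup E] [NormedAddCommGroup F]

lemma norm_toLp_le (v : E) (w : F) : ‖(WithLp.toLp 2 (v, w) : WithLp 2 (E × F))‖ ≤ ‖v‖ + ‖w‖ := by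
  rw [WithLp.prod_norm_eq_of_L2]
  refine Real.sqrt_le_iff.2 ⟨by positivity, ?_⟩
  change ‖v‖ ^ 2 + ‖w‖ ^ 2 ≤ _
  nlinarith [norm_nonneg v, norm_nonneg w]

lemma norm_toLp_sub_left (v v' : E) (w : F) :
    ‖(WithLp.toLp 2 (v, w) : WithLp 2 (E × F)) - WithLp.toLp 2 (v', w)‖ = ‖v - v'‖ := by
  rw [← WithLp.toLp_sub, Prod.mk_sub_mk, sub_self]
  exact WithLp.norm_toLp_fst 2 E F _

variable [InnerProductSpace ℝ E] [InnerProductSpace ℝ F]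

lemma hasFDerivAt_toLp_left (v : E) (w : F) :
    HasFDerivAt (fun v : E => (WithLp.toLp 2 (v, w) : WithLp 2 (E × F)))
      ((WithLp.prodContinuousLinearEquiv 2 ℝ E F).symm.toContinuousLinearMap ∘L
        ContinuousLinearMap.inl ℝ E F) v :=
  (WithLp.prodContinuousLinearEquiv 2 ℝ E F).symm.toContinuousLinearMap.hasFDerivAt.comp v
    (hasFDerivAt_prodMk_left v w)

lemma hasFDerivAt_toLp_right (v : E) (w : F) :
    HasFDerivAt (fun w : F => (WithLp.toLp 2 (v, w) : WithLp 2 (E × F)))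
      ((WithLp.prodContinuousLinearEquiv 2 ℝ E F).symm.toContinuousLinearMap ∘L
        ContinuousLinearMap.inr ℝ E F) w :=
  (WithLp.prodContinuousLinearEquiv 2 ℝ E F).symm.toContinuousLinearMap.hasFDerivAt.comp w
    (hasFDerivAt_prodMk_right v w)

variable [CompleteSpace E] [CompleteSpace F]

lemma gradient_fst {f : WithLp 2 (E × F) → ℝ} {v : E} {w : F}
    (hf : DifferentiableAt ℝ f (WithLp.toLp 2 (v, w))) :
    gradient (fun v => f (WithLp.toLp 2 (v, w))) v = (gradient f (WithLp.toLp 2 (v, w))).fst := by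
  rw [gradient_comp (hasFDerivAt_toLp_left v w) hf]
  refine ext_inner_right ℝ fun e => ?_
  rw [ContinuousLinearMap.adjoint_inner_left, WithLp.prod_inner_apply]
  simp

lemma gradient_snd {f : WithLp 2 (E × F) → ℝ} {v : E} {w : F}
    (hf : DifferentiableAt ℝ f (WithLp.toLp 2 (v, w))) :
    gradient (fun w => f (WithLp.toLp 2 (v, w))) w = (gradient f (WithLp.toLp 2 (v, w))).snd := by
  rw [gradient_comp (hasFDerivAt_toLp_right v w) hf]
  refine ext_inner_right ℝ fun e => ?_
  rw [ContinuousLinearMap.adjoint_inner_left, WithLp.prod_inner_apply]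
  simp

variable {ι : Type*} [Fintype ι] [DecidableEq ι] {H : ι → Type*}
  [∀ i, NormedAddCommGroup (H i)] [∀ i, InnerProductSpace ℝ (H i)] [∀ i, CompleteSpace (H i)]

lemma gradient_block {f : PiLp 2 H → ℝ} {x : PiLp 2 H} (hf : DifferentiableAt ℝ f x) (j : ι) :
    gradient f x j = gradient (fun y => f (WithLp.toLp 2 (Function.update x.ofLp j y))) (x j) := by
  have hx : WithLp.toLp 2 (Function.update x.ofLp j (x j)) = x := by
    simp
  have hg : HasFDerivAt (fun y : H j => WithLp.toLp 2 (Function.update x.ofLp j y))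
      ((PiLp.continuousLinearEquiv 2 ℝ H).symm.toContinuousLinearMap ∘L
        .pi (Pi.single j (.id ℝ (H j)))) (x j) :=
    (PiLp.continuousLinearEquiv 2 ℝ H).symm.toContinuousLinearMap.hasFDerivAt.comp (x j)
      (hasFDerivAt_update x.ofLp (x j))
  rw [gradient_comp hg (by rwa [hx]), hx]
  refine ext_inner_right ℝ fun e => ?_
  rw [ContinuousLinearMap.adjoint_inner_left, PiLp.inner_apply,
    Finset.sum_eq_single j]
  · simp
  · intro k _ hk
    simp [hk]
  · simp

end Gradient

/-! ### Backpropagation: splitting the loss at a machine -/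

namespace Pipeline

variable {n N : ℕ} (P : Pipeline n N) {S : Type*}

lemma activation_zero (ξ : Fin N) (x : P.Params) : P.activation ξ x 0 = P.first ξ (x 0) := rfl

lemma activation_succ (ξ : Fin N) (x : P.Params) (i : Fin n) :
    P.activation ξ x i.succ =
      P.next i (WithLp.toLp 2 (P.activation ξ x i.castSucc, x i.succ)) := rfl

lemma localActivation_zero (q : P.Quantizers S) (st : P.State) (d : Draw n N S) :
    P.localActivation q st d 0 = P.first d.1 (st.model 0) := rfl

lemma localActivation_succ (q : P.Quantizers S) (st : P.State) (d : Draw n N S) (i : Fin n) :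
    P.localActivation q st d i.succ =
      P.next i (WithLp.toLp 2 (P.messages q st d i, st.model i.succ)) := rfl

lemma tail_last (v : P.Act (Fin.last n)) (x : P.Params) : P.tail (Fin.last n) v x = P.loss v := by
  simp [tail]

lemma tail_castSucc (i : Fin n) (v : P.Act i.castSucc) (x : P.Params) :
    P.tail i.castSucc v x = P.tail i.succ (P.next i (WithLp.toLp 2 (v, x i.succ))) x := by
  simp [tail]

lemma machine_zero (ξ : Fin N) (m : P.Messages) (y : P.Par 0) : P.machine ξ m 0 y = P.first ξ y :=
  rfl

lemma machine_succ (ξ : Fin N) (m : P.Messages) (i : Fin n) (y : P.Par i.succ) :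
    P.machine ξ m i.succ y = P.next i (WithLp.toLp 2 (m i, y)) := rfl

lemma localActivation_eq_machine (q : P.Quantizers S) (st : P.State) (d : Draw n N S)
    (j : Fin (n + 1)) :
    P.localActivation q st d j = P.machine d.1 (P.messages q st d) j (st.model j) := by
  induction j using Fin.cases <;> rfl

/-- Feeding the exact activation of any machine to the rest of the pipeline gives the loss. -/
lemma sampleLoss_eq_tail (ξ : Fin N) (x : P.Params) (j : Fin (n + 1)) :
    P.sampleLoss ξ x = P.tail j (P.activation ξ x j) x := by
  induction j using Fin.reverseInduction with
  | last => rw [tail_last, sampleLoss]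
  | cast i ih => rw [ih, tail_castSucc, activation_succ]

/-- The rest of the pipeline only depends on the parameters of later machines. -/
lemma tail_congr (j : Fin (n + 1)) (v : P.Act j) {x y : P.Params} (h : ∀ k, j < k → x k = y k) :
    P.tail j v x = P.tail j v y := by
  induction j using Fin.reverseInduction with
  | last => rw [tail_last, tail_last]
  | cast i ih =>
    rw [tail_castSucc, tail_castSucc, h _ Fin.castSucc_lt_succ]
    exact ih _ fun k hk => h k (Fin.castSucc_lt_succ.trans hk)

/-- The exact activation only depends on the parameters of earlier machines. -/
lemma activation_congr (ξ : Fin N) (j : Fin (n + 1)) {x y : P.Params} (h : ∀ k ≤ j, x k = y k) :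
    P.activation ξ x j = P.activation ξ y j := by
  induction j using Fin.induction with
  | zero => rw [activation_zero, activation_zero, h 0 le_rfl]
  | succ i ih =>
    rw [activation_succ, activation_succ, h _ le_rfl,
      ih fun k hk => h k (hk.trans Fin.castSucc_lt_succ.le)]

/-- The model `x` with block `j` replaced by `y`. -/
def setBlock (x : P.Params) (j : Fin (n + 1)) (y : P.Par j) : P.Params :=
  WithLp.toLp 2 (Function.update x.ofLp j y)

lemma setBlock_self (x : P.Params) (j : Fin (n + 1)) (y : P.Par j) : P.setBlock x j y j = y := by
  simp [setBlock]

lemma setBlock_of_ne (x : P.Params) {j k : Fin (n + 1)} (h : k ≠ j) (y : P.Par j) :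
    P.setBlock x j y k = x k := by
  simp [setBlock, h]

/-- The gradient in block `j` of the loss seen by machine `j`, with messages `m` as input. -/
def blockGradient (ξ : Fin N) (m : P.Messages) (x : P.Params) (j : Fin (n + 1)) : P.Par j :=
  gradient (fun y => P.tail j (P.machine ξ m j y) x) (x j)

/-- The gradient of the loss after link `i` in the message on that link. -/
def linkGradient (i : Fin n) (v : P.Act i.castSucc) (x : P.Params) : P.Act i.castSucc :=
  gradient (fun v => P.tail i.castSucc v x) v

/-- The exact activations sent on all links. -/
def exactMessages (ξ : Fin N) (x : P.Params) : P.Messages := fun i => P.activation ξ x i.castSucc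

/-- Block `j` affects neither the activation entering machine `j` nor the map applied after it, so
the loss sees it only through `machine`. -/
lemma sampleLoss_setBlock (ξ : Fin N) (x : P.Params) (j : Fin (n + 1)) (y : P.Par j) :
    P.sampleLoss ξ (P.setBlock x j y) = P.tail j (P.machine ξ (P.exactMessages ξ x) j y) x := by
  rw [P.sampleLoss_eq_tail ξ _ j,
    P.tail_congr j _ (y := x) fun k hk => P.setBlock_of_ne x hk.ne' y]
  congr 1
  induction j using Fin.cases with
  | zero => rw [activation_zero, machine_zero, setBlock_self]
  | succ i =>
    rw [activation_succ, machine_succ, setBlock_self, exactMessages, P.activation_congr ξ i.castSucc (y := x)]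
    exact fun k hk => P.setBlock_of_ne x (hk.trans_lt Fin.castSucc_lt_succ).ne y

lemma blockGradient_zero (ξ : Fin N) (m m' : P.Messages) (x : P.Params) :
    P.blockGradient ξ m x 0 = P.blockGradient ξ m' x 0 := rfl

namespace LipschitzAssumptions

variable {P} {Lf : ℝ≥0} {c : PipelineConstants n} (hP : P.LipschitzAssumptions Lf c)
include hP

lemma linkGradient_eq (i : Fin n) (v : P.Act i.castSucc) (x : P.Params) :
    P.linkGradient i v x = (gradient (P.tailJoint i) (WithLp.toLp 2 (v, x))).fst :=
  gradient_fst ((hP.tail_lip i).1 _)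

lemma norm_linkGradient_le (i : Fin n) (v : P.Act i.castSucc) (x : P.Params) :
    ‖P.linkGradient i v x‖ ≤ c.tailBound i := by
  rw [hP.linkGradient_eq]
  exact (WithLp.norm_fst_le _ _).trans (hP.tail_bound i _)

lemma norm_linkGradient_sub_le (i : Fin n) (v w : P.Act i.castSucc) (x : P.Params) :
    ‖P.linkGradient i v x - P.linkGradient i w x‖ ≤ c.tailLip i * ‖v - w‖ := by
  rw [hP.linkGradient_eq, hP.linkGradient_eq, ← norm_toLp_sub_left v w x, ← WithLp.sub_fst]
  exact (WithLp.norm_fst_le _ _).trans ((hP.tail_lip i).2.norm_sub_le _ _)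

lemma differentiableAt_tail (i : Fin n) (v : P.Act i.castSucc) (x : P.Params) :
    DifferentiableAt ℝ (fun v => P.tail i.castSucc v x) v :=
  ((hP.tail_lip i).1 _).comp v (hasFDerivAt_toLp_left v x).differentiableAt

/-- A machine followed by the rest of the pipeline is the tail at its incoming link. Its block
gradient is thus a component of a gradient assumed Lipschitz, and no Lipschitz bound on the
derivative of the machine itself is required. -/
lemma blockGradient_succ (ξ : Fin N) (m : P.Messages) (x : P.Params) (i : Fin n) :
    P.blockGradient ξ m x i.succ =
      (gradient (P.tailJoint i) (WithLp.toLp 2 (m i, x))).snd i.succ := by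
  have hd : DifferentiableAt ℝ (fun x => P.tailJoint i (WithLp.toLp 2 (m i, x))) x :=
    ((hP.tail_lip i).1 _).comp x (hasFDerivAt_toLp_right _ x).differentiableAt
  rw [← gradient_snd ((hP.tail_lip i).1 _), gradient_block hd]
  unfold blockGradient
  congr 1
  funext y
  change _ = P.tail i.castSucc (m i) (P.setBlock x i.succ y)
  rw [tail_castSucc, machine_succ, setBlock_self]
  exact P.tail_congr _ _ fun k hk => (P.setBlock_of_ne x hk.ne' y).symm

lemma norm_blockGradient_succ_sub_le (ξ : Fin N) (m m' : P.Messages) (x : P.Params) (i : Fin n) :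
    ‖P.blockGradient ξ m x i.succ - P.blockGradient ξ m' x i.succ‖ ≤
      c.tailLip i * ‖m i - m' i‖ := by
  rw [hP.blockGradient_succ, hP.blockGradient_succ, ← norm_toLp_sub_left (m i) (m' i) x,
    ← PiLp.sub_apply, ← WithLp.sub_snd]
  exact (PiLp.norm_apply_le _ _).trans
    ((WithLp.norm_snd_le _ _).trans ((hP.tail_lip i).2.norm_sub_le _ _))

lemma differentiable_machine (ξ : Fin N) (m : P.Messages) (j : Fin (n + 1)) :
    Differentiable ℝ (P.machine ξ m j) := by
  induction j using Fin.cases with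
  | zero => exact (hP.first ξ).2.1
  | succ i =>
    exact (hP.next i).2.1.comp fun y => (hasFDerivAt_toLp_right (m i) y).differentiableAt

lemma norm_fderiv_machine_le (ξ : Fin N) (m : P.Messages) (j : Fin (n + 1)) (y : P.Par j) :
    ‖fderiv ℝ (P.machine ξ m j) y‖ ≤ c.bound j := by
  induction j using Fin.cases with
  | zero => exact (hP.first ξ).2.2 y
  | succ i =>
    have h := ((hP.next i).2.1 _).hasFDerivAt.comp y (hasFDerivAt_toLp_right (m i) y)
    have h' : fderiv ℝ (P.machine ξ m i.succ) y = _ := h.fderiv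
    rw [h']
    refine ContinuousLinearMap.opNorm_le_bound _ (c.bound i.succ).2 fun e => ?_
    have h1 := ContinuousLinearMap.le_of_opNorm_le _ ((hP.next i).2.2 (WithLp.toLp 2 (m i, y)))
      (WithLp.toLp 2 (0, e))
    rwa [WithLp.norm_toLp_snd] at h1

/-- The chain rule evaluates the link gradient at the machine's own output, whereas the algorithm
evaluates it at the message; the difference is part of the bias. -/
lemma blockGradient_castSucc (ξ : Fin N) (m : P.Messages) (x : P.Params) (i : Fin n) :
    P.blockGradient ξ m x i.castSucc = (fderiv ℝ (P.machine ξ m i.castSucc) (x i.castSucc)).adjoint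
      (P.linkGradient i (P.machine ξ m i.castSucc (x i.castSucc)) x) :=
  gradient_comp (hP.differentiable_machine ξ m i.castSucc _).hasFDerivAt
    (hP.differentiableAt_tail i _ x)

end LipschitzAssumptions

lemma direction_castSucc (q : P.Quantizers S) (st : P.State) (d : Draw n N S) (m : P.Messages)
    (i : Fin n) : P.direction q st d m i.castSucc =
      (fderiv ℝ (P.machine d.1 m i.castSucc) (st.model i.castSucc)).adjoint
        (q i (P.linkGradient i (m i) st.model) (d.2.2 i)) := by
  simp [direction, linkGradient]

lemma direction_last (q : P.Quantizers S) (st : P.State) (d : Draw n N S) (m : P.Messages) :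
    P.direction q st d m (Fin.last n) = P.blockGradient d.1 m st.model (Fin.last n) := by
  simp [direction, blockGradient, tail_last]

end Pipeline

/-! ### Measurability of one iteration -/

lemma measurable_comp_fin {α β : Type*} [MeasurableSpace α] [MeasurableSpace β] {N : ℕ}
    {g : Fin N → α → β} (hg : ∀ ξ, Measurable (g ξ)) {k : α → Fin N} (hk : Measurable k) :
    Measurable fun a => g (k a) a :=
  (measurable_from_prod_countable_right (f := fun p : Fin N × α => g p.1 p.2) hg).comp
    (hk.prodMk measurable_id)

/-- In coordinates the adjoint only involves `A a` on basis vectors, so pointwise measurability of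
`A` is enough. -/
lemma measurable_adjoint_apply {α F : Type*} [MeasurableSpace α] [NormedAddCommGroup F]
    [InnerProductSpace ℝ F] [CompleteSpace F] [MeasurableSpace F] [BorelSpace F]
    [SecondCountableTopology F] {p : ℕ} {A : α → EuclideanSpace ℝ (Fin p) →L[ℝ] F} {h : α → F}
    (hA : ∀ e, Measurable fun a => A a e) (hh : Measurable h) :
    Measurable fun a => (A a).adjoint (h a) := by
  have : (fun a => (A a).adjoint (h a)) =
      fun a => WithLp.toLp 2 fun b => inner ℝ (A a (EuclideanSpace.single b 1)) (h a) := by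
    funext a
    ext b
    change _ = inner ℝ (A a (EuclideanSpace.single b 1)) (h a)
    rw [← ContinuousLinearMap.adjoint_inner_right, EuclideanSpace.inner_single_left]
    simp
  rw [this]
  exact (WithLp.measurable_toLp 2 _).comp
    (measurable_pi_lambda _ fun b => (hA _).inner hh)

lemma measurable_gradient {E : Type*} [NormedAddCommGroup E] [InnerProductSpace ℝ E]
    [CompleteSpace E] [MeasurableSpace E] [BorelSpace E] (f : E → ℝ) :
    Measurable (gradient f) :=
  (InnerProductSpace.toDual ℝ E).symm.continuous.measurable.comp (measurable_fderiv ℝ f)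

namespace Pipeline

variable {n N : ℕ} (P : Pipeline n N) {S : Type*} [MeasurableSpace S]

instance : MeasurableSpace P.State :=
  MeasurableSpace.comap (fun st => (st.model, st.seen, st.buffer)) inferInstance

variable {α : Type*} [MeasurableSpace α] {P}

lemma measurable_state_tuple :
    Measurable fun st : P.State => (st.model, st.seen, st.buffer) :=
  comap_measurable _

lemma measurable_model : Measurable (State.model : P.State → P.Params) :=
  measurable_fst.comp measurable_state_tuple

lemma measurable_seen (ξ : Fin N) : Measurable fun st : P.State => st.seen ξ :=
  (measurable_pi_apply ξ).comp
    (measurable_fst.comp (measurable_snd.comp measurable_state_tuple))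

lemma measurable_buffer (ξ : Fin N) : Measurable fun st : P.State => st.buffer ξ :=
  (measurable_pi_apply ξ).comp
    (measurable_snd.comp (measurable_snd.comp measurable_state_tuple))

lemma measurable_state_mk {f : α → P.Params} {g : α → Fin N → Bool} {h : α → Fin N → P.Messages}
    (hf : Measurable f) (hg : Measurable g) (hh : Measurable h) :
    Measurable fun a => (⟨f a, g a, h a⟩ : P.State) :=
  measurable_comap_iff.2 (hf.prodMk (hg.prodMk hh))

lemma measurable_block {x : α → P.Params} (hx : Measurable x) (j : Fin (n + 1)) :
    Measurable fun a => x a j :=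
  (measurable_pi_apply j).comp ((WithLp.measurable_ofLp 2 _).comp hx)

lemma measurable_pair {j k : Fin (n + 1)} {v : α → P.Act j} {y : α → P.Par k} (hv : Measurable v)
    (hy : Measurable y) :
    Measurable fun a => (WithLp.toLp 2 (v a, y a) : WithLp 2 (P.Act j × P.Par k)) :=
  (WithLp.measurable_toLp 2 _).comp (hv.prodMk hy)

lemma measurable_update_sample {β : Type*} [MeasurableSpace β] {f : α → Fin N → β}
    {k : α → Fin N} {b : α → β} (hf : Measurable f) (hk : Measurable k) (hb : Measurable b) :
    Measurable fun a => Function.update (f a) (k a) (b a) := by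
  refine measurable_comp_fin (g := fun ξ a => Function.update (f a) ξ (b a))
    (fun ξ => measurable_pi_lambda _ fun ξ' => ?_) hk
  by_cases h : ξ' = ξ
  · subst h; simpa using hb
  · simp only [Function.update_of_ne h]
    exact (measurable_pi_apply ξ').comp hf

lemma measurable_send {q : P.Quantizers S} (hq : ∀ i, Measurable (Function.uncurry (q i)))
    {st : α → P.State} {d : α → Draw n N S} (hst : Measurable st) (hd : Measurable d)
    (i : Fin n) {v : α → P.Act i.castSucc} (hv : Measurable v) :
    Measurable fun a => P.send q (st a) (d a) i (v a) := by
  have hb : ∀ ξ, Measurable fun a => (st a).buffer ξ i := fun ξ =>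
    (measurable_pi_apply i).comp ((measurable_buffer ξ).comp hst)
  refine measurable_comp_fin (g := fun ξ a => if (st a).seen ξ then
    (st a).buffer ξ i + q i (v a - (st a).buffer ξ i) ((d a).2.1 i) else v a)
    (fun ξ => Measurable.ite ?_ ?_ hv) (measurable_fst.comp hd)
  · exact ((measurable_seen ξ).comp hst) (measurableSet_singleton true)
  · exact (hb ξ).add ((hq i).comp ((hv.sub (hb ξ)).prodMk
      ((measurable_pi_apply i).comp (measurable_fst.comp (measurable_snd.comp hd)))))

namespace LipschitzAssumptions

variable {Lf : ℝ≥0} {c : PipelineConstants n} (hP : P.LipschitzAssumptions Lf c)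
include hP

lemma measurable_activation (ξ : Fin N) (j : Fin (n + 1)) :
    Measurable fun x : P.Params => P.activation ξ x j := by
  induction j using Fin.induction with
  | zero => exact (hP.first ξ).1.continuous.measurable.comp (measurable_block measurable_id 0)
  | succ i ih =>
    exact (hP.next i).1.continuous.measurable.comp
      (measurable_pair ih (measurable_block measurable_id _))

lemma measurable_linkGradient (i : Fin n) {v : α → P.Act i.castSucc} {x : α → P.Params}
    (hv : Measurable v) (hx : Measurable x) :
    Measurable fun a => P.linkGradient i (v a) (x a) := by
  simp only [hP.linkGradient_eq]
  exact measurable_fst.comp ((WithLp.measurable_ofLp 2 _).comp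
    ((hP.tail_lip i).2.continuous.measurable.comp
      ((WithLp.measurable_toLp 2 _).comp (hv.prodMk hx))))

lemma measurable_blockGradient {j : Fin (n + 1)} (hj : j ≠ 0) {k : α → Fin N}
    {m : α → P.Messages} {x : α → P.Params} (hm : Measurable m) (hx : Measurable x) :
    Measurable fun a => P.blockGradient (k a) (m a) (x a) j := by
  induction j using Fin.cases with
  | zero => exact absurd rfl hj
  | succ i =>
    simp only [hP.blockGradient_succ]
    exact measurable_block (measurable_snd.comp ((WithLp.measurable_ofLp 2 _).comp
      ((hP.tail_lip i).2.continuous.measurable.comp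
        ((WithLp.measurable_toLp 2 _).comp (((measurable_pi_apply i).comp hm).prodMk hx))))) _

lemma measurable_fderiv_machine (j : Fin (n + 1)) {k : α → Fin N}
    {m : α → P.Messages} {x : α → P.Params} (hk : Measurable k) (hm : Measurable m)
    (hx : Measurable x) (e : P.Par j) :
    Measurable fun a => fderiv ℝ (P.machine (k a) (m a) j) (x a j) e := by
  induction j using Fin.cases with
  | zero =>
    exact measurable_comp_fin (g := fun ξ a => fderiv ℝ (P.first ξ) (x a 0) e)
      (fun ξ => (measurable_fderiv_apply_const ℝ (P.first ξ) e).comp (measurable_block hx 0)) hk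
  | succ i =>
    have h : ∀ a, fderiv ℝ (P.machine (k a) (m a) i.succ) (x a i.succ) e =
        fderiv ℝ (P.next i) (WithLp.toLp 2 (m a i, x a i.succ)) (WithLp.toLp 2 (0, e)) := by
      intro a
      have h := ((hP.next i).2.1 _).hasFDerivAt.comp (x a i.succ)
        (hasFDerivAt_toLp_right (m a i) (x a i.succ))
      have h' : fderiv ℝ (P.machine (k a) (m a) i.succ) (x a i.succ) = _ := h.fderiv
      rw [h']
      rfl
    simp only [h]
    exact (measurable_fderiv_apply_const ℝ (P.next i) _).comp
      (measurable_pair ((measurable_pi_apply i).comp hm) (measurable_block hx _))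

variable {q : P.Quantizers S} (hq : ∀ i, Measurable (Function.uncurry (q i)))
include hq

lemma measurable_localActivation {st : α → P.State} {d : α → Draw n N S} (hst : Measurable st)
    (hd : Measurable d) (j : Fin (n + 1)) :
    Measurable fun a => P.localActivation q (st a) (d a) j := by
  have hx := measurable_model.comp hst
  induction j using Fin.induction with
  | zero =>
    exact measurable_comp_fin (g := fun ξ a => P.first ξ ((st a).model 0))
      (fun ξ => (hP.first ξ).1.continuous.measurable.comp (measurable_block hx 0))
      (measurable_fst.comp hd)
  | succ i ih =>
    exact (hP.next i).1.continuous.measurable.comp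
      (measurable_pair (measurable_send hq hst hd i ih) (measurable_block hx _))

lemma measurable_messages {st : α → P.State} {d : α → Draw n N S} (hst : Measurable st)
    (hd : Measurable d) : Measurable fun a => P.messages q (st a) (d a) :=
  measurable_pi_lambda _ fun i =>
    measurable_send hq hst hd i (hP.measurable_localActivation hq hst hd _)

lemma measurable_direction (hn : n ≠ 0) {st : α → P.State} {d : α → Draw n N S}
    (hst : Measurable st) (hd : Measurable d) (j : Fin (n + 1)) :
    Measurable fun a => P.direction q (st a) (d a) (P.messages q (st a) (d a)) j := by
  have hm := hP.measurable_messages hq hst hd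
  have hx := measurable_model.comp hst
  induction j using Fin.lastCases with
  | last =>
    simp only [direction_last]
    exact hP.measurable_blockGradient (by simpa [Fin.ext_iff] using hn) hm hx
  | cast i =>
    simp only [direction_castSucc]
    exact measurable_adjoint_apply
      (hP.measurable_fderiv_machine _ (measurable_fst.comp hd) hm hx)
      ((hq i).comp ((hP.measurable_linkGradient i ((measurable_pi_apply i).comp hm) hx).prodMk
        ((measurable_pi_apply i).comp (measurable_snd.comp (measurable_snd.comp hd)))))

lemma measurable_toLp_direction (hn : n ≠ 0) {st : α → P.State} {d : α → Draw n N S}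
    (hst : Measurable st) (hd : Measurable d) :
    Measurable fun a => (WithLp.toLp 2
      (P.direction q (st a) (d a) (P.messages q (st a) (d a))) : P.Params) :=
  (WithLp.measurable_toLp 2 _).comp
    (measurable_pi_lambda _ fun j => hP.measurable_direction hq hn hst hd j)

lemma measurable_step (hn : n ≠ 0) (γ : ℝ) :
    Measurable fun p : P.State × Draw n N S => P.step q γ p.1 p.2 := by
  have hm := hP.measurable_messages hq (measurable_fst (α := P.State) (β := Draw n N S))
    measurable_snd
  refine measurable_state_mk
    ((measurable_model.comp measurable_fst).sub
      ((hP.measurable_toLp_direction hq hn measurable_fst measurable_snd).const_smul γ))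
    (measurable_update_sample (measurable_pi_lambda _ fun ξ => (measurable_seen ξ).comp
      measurable_fst) (measurable_fst.comp measurable_snd) measurable_const)
    (measurable_update_sample (measurable_pi_lambda _ fun ξ => (measurable_buffer ξ).comp
      measurable_fst) (measurable_fst.comp measurable_snd) hm)

end LipschitzAssumptions

end Pipeline

/-! ### Weighted buffer errors and their contraction at a visit -/

namespace PipelineConstants

variable {n : ℕ} (c : PipelineConstants n)

/-- A common Lipschitz constant of all machines, at least one. -/
def lipMax : ℝ := 1 + ∑ j, (c.lip j : ℝ)

/-- A common bound of the derivatives of all machines, at least one. -/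
def boundMax : ℝ := 1 + ∑ j, (c.bound j : ℝ)

/-- A common Lipschitz constant of the gradients of all tails, at least one. -/
def tailLipMax : ℝ := 1 + ∑ i, (c.tailLip i : ℝ)

lemma one_le_lipMax : 1 ≤ c.lipMax := le_add_of_nonneg_right (by positivity)

lemma one_le_boundMax : 1 ≤ c.boundMax := le_add_of_nonneg_right (by positivity)

lemma lip_le (j : Fin (n + 1)) : (c.lip j : ℝ) ≤ c.lipMax := by
  have := Finset.single_le_sum (f := fun j => (c.lip j : ℝ)) (fun j _ => (c.lip j).2)
    (Finset.mem_univ j)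
  unfold lipMax; linarith

lemma bound_le (j : Fin (n + 1)) : (c.bound j : ℝ) ≤ c.boundMax := by
  have := Finset.single_le_sum (f := fun j => (c.bound j : ℝ)) (fun j _ => (c.bound j).2)
    (Finset.mem_univ j)
  unfold boundMax; linarith

lemma tailLip_le (i : Fin n) : (c.tailLip i : ℝ) ≤ c.tailLipMax := by
  have := Finset.single_le_sum (f := fun i => (c.tailLip i : ℝ)) (fun i _ => (c.tailLip i).2)
    (Finset.mem_univ i)
  unfold tailLipMax; linarith

/-- The weight of the error on link `i` in the Lyapunov function. -/
def weight (i : ℕ) : ℝ := (1 / (100 * c.lipMax ^ 2)) ^ i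

lemma hundred_lipMax_sq_ge : 1 ≤ 100 * c.lipMax ^ 2 := by nlinarith [c.one_le_lipMax]

lemma weight_pos (i : ℕ) : 0 < c.weight i := by
  have := c.hundred_lipMax_sq_ge
  unfold weight; positivity

lemma weight_le_one (i : ℕ) : c.weight i ≤ 1 := by
  have := c.hundred_lipMax_sq_ge
  exact pow_le_one₀ (by positivity) (by rw [div_le_one (by positivity)]; exact this)

/-- Passing through a machine amplifies a squared error by at most `lipMax ^ 2`; the next weight
turns this amplification into a loss of a factor `100`. -/
lemma weight_succ_mul (i : ℕ) : c.weight (i + 1) * c.lipMax ^ 2 = c.weight i / 100 := by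
  have := c.one_le_lipMax
  unfold weight; rw [pow_succ]; field_simp

lemma one_le_mul_weight {i : ℕ} (hi : i ≤ n) : 1 ≤ (100 * c.lipMax ^ 2) ^ n * c.weight i := by
  have h := c.hundred_lipMax_sq_ge
  unfold weight
  rw [one_div, inv_pow, ← div_eq_mul_inv, one_le_div (by positivity)]
  exact pow_le_pow_right₀ h hi

end PipelineConstants

namespace Pipeline

variable {n N : ℕ} {P : Pipeline n N} {S : Type*}

/-- The squared error of the buffered message of sample `ξ` on link `i`; zero before the first
visit. -/
def bufferError (st : P.State) (ξ : Fin N) (i : Fin n) : ℝ :=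
  if st.seen ξ then ‖st.buffer ξ i - P.exactMessages ξ st.model i‖ ^ 2 else 0

lemma bufferError_nonneg (st : P.State) (ξ : Fin N) (i : Fin n) : 0 ≤ bufferError st ξ i := by
  unfold bufferError; split_ifs <;> positivity

/-- The weighted error of the buffer of sample `ξ`. -/
def sampleError (c : PipelineConstants n) (st : P.State) (ξ : Fin N) : ℝ :=
  ∑ i : Fin n, c.weight i * bufferError st ξ i

lemma sampleError_nonneg (c : PipelineConstants n) (st : P.State) (ξ : Fin N) :
    0 ≤ sampleError c st ξ :=
  Finset.sum_nonneg fun i _ => mul_nonneg (c.weight_pos i).le (bufferError_nonneg st ξ i)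

/-- The weighted error of all buffers. -/
def totalError (c : PipelineConstants n) (st : P.State) : ℝ := ∑ ξ, sampleError c st ξ

lemma totalError_nonneg (c : PipelineConstants n) (st : P.State) : 0 ≤ totalError c st :=
  Finset.sum_nonneg fun ξ _ => sampleError_nonneg c st ξ

lemma sampleError_le_totalError (c : PipelineConstants n) (st : P.State) (ξ : Fin N) :
    sampleError c st ξ ≤ totalError c st :=
  Finset.single_le_sum (fun ξ _ => sampleError_nonneg c st ξ) (Finset.mem_univ ξ)

/-- The error of the current message on link `i`. -/
def messageError (q : P.Quantizers S) (st : P.State) (d : Draw n N S) (i : Fin n) : ℝ :=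
  ‖P.messages q st d i - P.exactMessages d.1 st.model i‖ ^ 2

/-- The error of the current activation of machine `j`. -/
def activationError (q : P.Quantizers S) (st : P.State) (d : Draw n N S) (j : Fin (n + 1)) : ℝ :=
  ‖P.localActivation q st d j - P.activation d.1 st.model j‖ ^ 2

/-- The weighted error of the current messages. -/
def visitError (c : PipelineConstants n) (q : P.Quantizers S) (st : P.State) (d : Draw n N S) : ℝ :=
  ∑ i : Fin n, c.weight i * messageError q st d i

lemma messageError_nonneg (q : P.Quantizers S) (st : P.State) (d : Draw n N S) (i : Fin n) :
    0 ≤ messageError q st d i := sq_nonneg _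

lemma activationError_nonneg (q : P.Quantizers S) (st : P.State) (d : Draw n N S)
    (j : Fin (n + 1)) : 0 ≤ activationError q st d j := sq_nonneg _

lemma visitError_nonneg (c : PipelineConstants n) (q : P.Quantizers S) (st : P.State)
    (d : Draw n N S) : 0 ≤ visitError c q st d :=
  Finset.sum_nonneg fun i _ => mul_nonneg (c.weight_pos i).le (messageError_nonneg q st d i)

lemma activationError_zero (q : P.Quantizers S) (st : P.State) (d : Draw n N S) :
    activationError q st d 0 = 0 := by
  simp [activationError, localActivation_zero, activation_zero]

/-- The activation of machine `j` does not depend on the seeds of later links. -/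
lemma localActivation_congr (q : P.Quantizers S) (st : P.State) (ξ : Fin N) {s s' t : Fin n → S}
    (j : Fin (n + 1)) (h : ∀ k : Fin n, k.castSucc < j → s k = s' k) :
    P.localActivation q st (ξ, s, t) j = P.localActivation q st (ξ, s', t) j := by
  induction j using Fin.induction with
  | zero => rfl
  | succ i ih =>
    have h1 := ih fun k hk => h k (hk.trans Fin.castSucc_lt_succ)
    rw [localActivation_succ, localActivation_succ]
    simp only [messages, send, h1, h i Fin.castSucc_lt_succ]

namespace LipschitzAssumptions

variable {Lf : ℝ≥0} {c : PipelineConstants n} (hP : P.LipschitzAssumptions Lf c)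
include hP

lemma activationError_succ_le (q : P.Quantizers S) (st : P.State) (d : Draw n N S) (i : Fin n) :
    activationError q st d i.succ ≤ c.lipMax ^ 2 * messageError q st d i := by
  unfold activationError messageError
  rw [localActivation_succ, activation_succ, ← mul_pow]
  gcongr
  refine ((hP.next i).1.norm_sub_le _ _).trans ?_
  rw [norm_toLp_sub_left]
  exact mul_le_mul_of_nonneg_right (c.lip_le _) (norm_nonneg _)

lemma sum_activationError_le (q : P.Quantizers S) (st : P.State) (d : Draw n N S) :
    ∑ i : Fin n, activationError q st d i.castSucc ≤
      c.lipMax ^ 2 * ∑ i : Fin n, messageError q st d i := by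
  have h1 := Fin.sum_univ_succ (fun j => activationError q st d j)
  rw [Fin.sum_univ_castSucc, activationError_zero, zero_add] at h1
  have h2 := activationError_nonneg q st d (Fin.last n)
  have h3 := Finset.sum_le_sum fun i (_ : i ∈ Finset.univ) => hP.activationError_succ_le q st d i
  rw [← Finset.mul_sum] at h3
  linarith

/-- The first activation is exact and every later one inherits its error from the preceding link, so
the sum shifts by one index and `weight_succ_mul` supplies the factor `1 / 100`. -/
lemma sum_weight_activationError_le (q : P.Quantizers S) (st : P.State) (d : Draw n N S) :
    ∑ i : Fin n, c.weight i * activationError q st d i.castSucc ≤ visitError c q st d / 100 := by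
  have h1 := Fin.sum_univ_succ (fun j : Fin (n + 1) => c.weight j * activationError q st d j)
  rw [Fin.sum_univ_castSucc, activationError_zero, mul_zero, zero_add] at h1
  have h2 := mul_nonneg (c.weight_pos n).le (activationError_nonneg q st d (Fin.last n))
  have h3 : ∑ i : Fin n, c.weight (i + 1) * activationError q st d i.succ ≤
      visitError c q st d / 100 := by
    rw [visitError, Finset.sum_div]
    refine Finset.sum_le_sum fun i _ => ?_
    refine (mul_le_mul_of_nonneg_left (hP.activationError_succ_le q st d i)
      (c.weight_pos _).le).trans_eq ?_
    rw [← mul_assoc, c.weight_succ_mul]; ring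
  simp only [Fin.val_castSucc, Fin.val_last, Fin.val_succ] at h1
  linarith

section Visit

variable [MeasurableSpace S] {ν : Measure S} {q : P.Quantizers S} {cQ : ℝ}
  (hq : ∀ i, IsUnbiasedQuantizer ν (q i) cQ)
include hq

lemma measurable_messageError (st : P.State) (i : Fin n) :
    Measurable fun d : Draw n N S => messageError q st d i :=
  ((((measurable_pi_apply i).comp (hP.measurable_messages (fun i => (hq i).measurable)
    (measurable_const (a := st)) measurable_id)).sub
      (measurable_of_finite (fun ξ : Fin N => P.exactMessages ξ st.model i) |>.comp
        measurable_fst)).norm).pow_const 2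

lemma measurable_activationError (st : P.State) (j : Fin (n + 1)) :
    Measurable fun d : Draw n N S => activationError q st d j :=
  (((hP.measurable_localActivation (fun i => (hq i).measurable)
    (measurable_const (a := st)) measurable_id j).sub
      (measurable_of_finite (fun ξ : Fin N => P.activation ξ st.model j) |>.comp
        measurable_fst)).norm).pow_const 2

lemma measurable_visitError (st : P.State) :
    Measurable fun d : Draw n N S => visitError c q st d :=
  Finset.measurable_fun_sum _ fun i _ => (hP.measurable_messageError hq st i).const_mul _

variable [IsProbabilityMeasure ν]

/-- The error on one link after a visit: the old error contracts. -/
lemma meanLE_messageError (hcQ : cQ ^ 2 ≤ 1 / 2) (st : P.State) (ξ : Fin N) (i : Fin n)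
    (hi : Integrable (fun s => activationError q st (ξ, s, s) i.castSucc)
      (Measure.pi fun _ : Fin n => ν)) :
    MeanLE (Measure.pi fun _ : Fin n => ν) (fun s => messageError q st (ξ, s, s) i)
      (18 / 25 * bufferError st ξ i +
        10 * ∫ s, activationError q st (ξ, s, s) i.castSucc ∂(Measure.pi fun _ : Fin n => ν)) := by
  have hm : Measurable fun s : Fin n → S => messageError q st (ξ, s, s) i :=
    (hP.measurable_messageError hq st i).comp
      (measurable_const.prodMk (measurable_id.prodMk measurable_id))
  refine MeanLE.of_update i hm (fun s => messageError_nonneg _ _ _ _)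
    (h := fun s => 18 / 25 * bufferError st ξ i + 10 * activationError q st (ξ, s, s) i.castSucc)
    ?_ ((MeanLE.const _).add (MeanLE.const_mul ⟨hi, le_rfl⟩ (by norm_num)))
  intro s
  have hm' : Measurable fun y => messageError q st (ξ, Function.update s i y, Function.update s i y) i :=
    hm.comp (measurable_update s)
  set u := P.localActivation q st (ξ, s, s) i.castSucc with hu
  set a := P.exactMessages ξ st.model i with ha
  have hε : activationError q st (ξ, s, s) i.castSucc = ‖u - a‖ ^ 2 := rfl
  have hmsg : ∀ y, P.messages q st (ξ, Function.update s i y, Function.update s i y) i =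
      if st.seen ξ then st.buffer ξ i + q i (u - st.buffer ξ i) y else u := by
    intro y
    have h1 : P.localActivation q st (ξ, Function.update s i y, Function.update s i y) i.castSucc
        = u :=
      P.localActivation_congr q st ξ (t := s) i.castSucc fun k hk => by
        rw [Function.update_of_ne (ne_of_lt (Fin.castSucc_lt_castSucc_iff.1 hk))]
    simp only [messages, send, h1, Function.update_self]
  by_cases hs : st.seen ξ
  · set v := u - st.buffer ξ i with hv
    have hV : bufferError st ξ i = ‖st.buffer ξ i - a‖ ^ 2 := by simp [bufferError, hs, ha]
    -- Young with `β = 1 / 5` is used twice, here and for the new error. The old error gets `6/5 *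
    -- 1/2 * 6/5 = 18/25`, and the activation error gets `6/5 * 1/2 * 6 + 6 = 9.6 ≤ 10`.
    have hvn : ‖v‖ ^ 2 ≤ 6 / 5 * bufferError st ξ i + 6 * ‖u - a‖ ^ 2 := by
      have := norm_add_sq_le_young (a - st.buffer ξ i) (u - a) (β := 1 / 5) (by norm_num)
      rw [norm_sub_rev a, ← hV] at this
      have e : a - st.buffer ξ i + (u - a) = v := by rw [hv]; abel
      rw [e] at this
      linarith
    have hE : MeanLE ν (fun y => ‖v - q i v y‖ ^ 2) (1 / 2 * ‖v‖ ^ 2) :=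
      ⟨(hq i).integrable_sq v, ((hq i).error_le v).trans (by gcongr)⟩
    refine ((((hE.const_mul (a := 6 / 5) (by norm_num)).add
      (MeanLE.const (6 * ‖u - a‖ ^ 2))).mono hm' (fun _ => messageError_nonneg _ _ _ _)
      fun y => ?_).weaken ?_)
    · have := norm_add_sq_le_young (q i v y - v) (u - a) (β := 1 / 5) (by norm_num)
      unfold messageError
      rw [hmsg, if_pos hs]
      rw [norm_sub_rev (q i v y)] at this
      have e : q i v y - v + (u - a) = st.buffer ξ i + q i v y - a := by rw [hv]; abel
      rw [e] at this
      linarith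
    · rw [hε]; nlinarith [sq_nonneg ‖u - a‖]
  · refine ((MeanLE.const (‖u - a‖ ^ 2)).mono hm' (fun _ => messageError_nonneg _ _ _ _)
      fun y => ?_).weaken ?_
    · unfold messageError
      rw [hmsg, if_neg hs]
    · rw [hε]; nlinarith [sq_nonneg ‖u - a‖, bufferError_nonneg st ξ i]

/-- Induction along the pipeline, alternating between links and machines. Finiteness of these means
is what permits absorbing the visit error into itself in `meanLE_visitError`. -/
lemma integrable_activationError (hcQ : cQ ^ 2 ≤ 1 / 2) (st : P.State) (ξ : Fin N)
    (j : Fin (n + 1)) :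
    Integrable (fun s => activationError q st (ξ, s, s) j) (Measure.pi fun _ : Fin n => ν) := by
  induction j using Fin.induction with
  | zero => simp [activationError_zero]
  | succ i ih =>
    exact (((hP.meanLE_messageError hq hcQ st ξ i ih).const_mul (sq_nonneg c.lipMax)).mono
      ((hP.measurable_activationError hq st i.succ).comp
        (measurable_const.prodMk (measurable_id.prodMk measurable_id)))
      (fun _ => activationError_nonneg _ _ _ _)
      (fun s => hP.activationError_succ_le q st (ξ, s, s) i)).1

/-- A visit contracts the weighted error of the sample. -/
lemma meanLE_visitError (hcQ : cQ ^ 2 ≤ 1 / 2) (st : P.State) (ξ : Fin N) :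
    MeanLE (Measure.pi fun _ : Fin n => ν) (fun s => visitError c q st (ξ, s, s))
      (4 / 5 * sampleError c st ξ) := by
  have hint := hP.integrable_activationError hq hcQ st ξ
  have h1 := MeanLE.sum (Finset.univ : Finset (Fin n)) fun i _ =>
    (hP.meanLE_messageError hq hcQ st ξ i (hint i.castSucc)).const_mul (c.weight_pos i).le
  refine ⟨h1.1, ?_⟩
  have h2 := h1.2
  have h3 : ∑ i : Fin n, c.weight i *
      ∫ s, activationError q st (ξ, s, s) i.castSucc ∂(Measure.pi fun _ : Fin n => ν) ≤
      (∫ s, visitError c q st (ξ, s, s) ∂(Measure.pi fun _ : Fin n => ν)) / 100 := by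
    simp only [← integral_const_mul]
    rw [← integral_finsetSum _ fun i _ => (hint i.castSucc).const_mul _, ← integral_div]
    exact integral_mono (integrable_finsetSum _ fun i _ => (hint i.castSucc).const_mul _)
      (h1.1.div_const _) fun s => hP.sum_weight_activationError_le q st (ξ, s, s)
  have h4 : ∑ i : Fin n, c.weight i * (18 / 25 * bufferError st ξ i +
      10 * ∫ s, activationError q st (ξ, s, s) i.castSucc ∂(Measure.pi fun _ : Fin n => ν)) =
      18 / 25 * sampleError c st ξ + 10 * ∑ i : Fin n, c.weight i *
      ∫ s, activationError q st (ξ, s, s) i.castSucc ∂(Measure.pi fun _ : Fin n => ν) := by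
    rw [sampleError, Finset.mul_sum, Finset.mul_sum, ← Finset.sum_add_distrib]
    exact Finset.sum_congr rfl fun i _ => by ring
  rw [h4] at h2
  change ∫ s, visitError c q st (ξ, s, s) ∂_ ≤ _ at h2
  -- With `V` the mean visit error, `V ≤ 18/25 * sampleError + 10 * V / 100`, and `(18/25) / (9/10)
  -- = 4/5`.
  linarith

end Visit

end LipschitzAssumptions

end Pipeline

/-! ### Means over one draw -/

section DrawLaw

variable {n N : ℕ} {S : Type*} [MeasurableSpace S] {ν : Measure S} [IsProbabilityMeasure ν]

lemma isProbabilityMeasure_drawLaw (hN : 1 ≤ N) :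
    IsProbabilityMeasure (Pipeline.drawLaw n N ν) := by
  have : Nonempty (Fin N) := ⟨⟨0, hN⟩⟩
  unfold Pipeline.drawLaw
  infer_instance

/-- The averages are taken in the order gradient seeds, activation seeds, sample, the reverse of the
order in which an iteration uses them. -/
lemma MeanLE.drawLaw (hN : 1 ≤ N) {f : Pipeline.Draw n N S → ℝ} (hf : Measurable f)
    (h0 : ∀ d, 0 ≤ f d) {g : Fin N → (Fin n → S) → ℝ} {h : Fin N → ℝ} {a : ℝ}
    (hfg : ∀ ξ s, MeanLE (Measure.pi fun _ : Fin n => ν) (fun t => f (ξ, s, t)) (g ξ s))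
    (hgh : ∀ ξ, MeanLE (Measure.pi fun _ : Fin n => ν) (g ξ) (h ξ))
    (ha : (∑ ξ, h ξ) / N ≤ a) : MeanLE (Pipeline.drawLaw n N ν) f a := by
  have : Nonempty (Fin N) := ⟨⟨0, hN⟩⟩
  exact MeanLE.prod hf h0 (fun ξ => MeanLE.prod (hf.comp measurable_prodMk_left)
    (fun p => h0 _) (fun s => hfg ξ s) (hgh ξ)) (MeanLE.uniformOn_univ hN ha)

lemma MeanLE.drawLaw_sample (hN : 1 ≤ N) {f : Fin N → ℝ} {a : ℝ} (ha : (∑ ξ, f ξ) / N ≤ a) :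
    MeanLE (Pipeline.drawLaw n N ν) (fun d => f d.1) a := by
  have : Nonempty (Fin N) := ⟨⟨0, hN⟩⟩
  have h := MeanLE.uniformOn_univ hN ha
  refine ⟨h.1.comp_fst _, ?_⟩
  unfold Pipeline.drawLaw
  rw [integral_fun_fst]
  simpa using h.2

/-- The function changes sign, so the dominating `g` provides integrability before the conditional
means over the gradient seeds are used. -/
lemma MeanLE.drawLaw_zero (hN : 1 ≤ N) {f g : Pipeline.Draw n N S → ℝ} {a : ℝ} (hf : Measurable f)
    (hg : MeanLE (Pipeline.drawLaw n N ν) g a) (hfg : ∀ d, |f d| ≤ g d)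
    (h : ∀ ξ s, ∫ t, f (ξ, s, t) ∂(Measure.pi fun _ : Fin n => ν) = 0) :
    MeanLE (Pipeline.drawLaw n N ν) f 0 := by
  have : Nonempty (Fin N) := ⟨⟨0, hN⟩⟩
  have hi : Integrable f (Pipeline.drawLaw n N ν) :=
    hg.1.mono' hf.aestronglyMeasurable (Filter.Eventually.of_forall hfg)
  refine ⟨hi, le_of_eq ?_⟩
  unfold Pipeline.drawLaw at hi ⊢
  rw [integral_prod _ hi]
  refine integral_eq_zero_of_ae ?_
  filter_upwards [hi.prod_right_ae] with ξ hξ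
  rw [integral_prod _ hξ]
  simp only [h, integral_zero, Pi.zero_apply]

end DrawLaw

/-! ### Bias and noise of the update -/

namespace PipelineConstants

variable {n : ℕ} (c : PipelineConstants n)

/-- The factor between the squared bias of the update and the weighted error of the messages. -/
def biasFactor : ℝ :=
  (4 * c.boundMax ^ 2 * c.tailLipMax ^ 2 * (1 + c.lipMax ^ 2) + 2 * c.tailLipMax ^ 2) *
    (100 * c.lipMax ^ 2) ^ n

lemma biasFactor_nonneg : 0 ≤ c.biasFactor := by unfold biasFactor; positivity

end PipelineConstants

namespace Pipeline

variable {n N : ℕ} {P : Pipeline n N} {S : Type*}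

/-- The update direction of one iteration. -/
def update (q : P.Quantizers S) (st : P.State) (d : Draw n N S) : P.Params :=
  WithLp.toLp 2 (P.direction q st d (P.messages q st d))

/-- The part of the update direction that is due to the quantization of the gradients. -/
def noise (q : P.Quantizers S) (st : P.State) (d : Draw n N S) : P.Params :=
  WithLp.toLp 2 fun j => Fin.lastCases (motive := fun j => P.Par j) 0
    (fun i => (fderiv ℝ (P.machine d.1 (P.messages q st d) i.castSucc)
      (st.model i.castSucc)).adjoint
        (q i (P.linkGradient i (P.messages q st d i) st.model) (d.2.2 i) -
          P.linkGradient i (P.messages q st d i) st.model)) j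

/-- The part of the update direction that is due to the errors of the messages. -/
def bias (q : P.Quantizers S) (st : P.State) (d : Draw n N S) : P.Params :=
  update q st d - noise q st d - gradient (P.sampleLoss d.1) st.model

lemma update_eq (q : P.Quantizers S) (st : P.State) (d : Draw n N S) :
    update q st d = gradient (P.sampleLoss d.1) st.model + bias q st d + noise q st d := by
  unfold bias; abel

lemma noise_last (q : P.Quantizers S) (st : P.State) (d : Draw n N S) :
    noise q st d (Fin.last n) = 0 := by
  simp [noise]

lemma noise_castSucc (q : P.Quantizers S) (st : P.State) (d : Draw n N S) (i : Fin n) :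
    noise q st d i.castSucc =
      (fderiv ℝ (P.machine d.1 (P.messages q st d) i.castSucc) (st.model i.castSucc)).adjoint
        (q i (P.linkGradient i (P.messages q st d i) st.model) (d.2.2 i) -
          P.linkGradient i (P.messages q st d i) st.model) := by
  simp [noise]

lemma norm_adjoint_apply_le {E F : Type*} [NormedAddCommGroup E] [InnerProductSpace ℝ E]
    [CompleteSpace E] [NormedAddCommGroup F] [InnerProductSpace ℝ F] [CompleteSpace F]
    {A : E →L[ℝ] F} {b : ℝ} (hA : ‖A‖ ≤ b) (v : F) : ‖A.adjoint v‖ ≤ b * ‖v‖ :=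
  ContinuousLinearMap.le_of_opNorm_le _ (by rwa [LinearIsometryEquiv.norm_map]) v

namespace LipschitzAssumptions

variable {Lf : ℝ≥0} {c : PipelineConstants n} (hP : P.LipschitzAssumptions Lf c)
include hP

lemma differentiable_activation (ξ : Fin N) (j : Fin (n + 1)) :
    Differentiable ℝ fun x : P.Params => P.activation ξ x j := by
  have hproj : ∀ j, Differentiable ℝ fun x : P.Params => x j := fun j =>
    (PiLp.proj 2 (𝕜 := ℝ) P.Par j).differentiable
  induction j using Fin.induction with
  | zero => exact (hP.first ξ).2.1.comp (hproj 0)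
  | succ i ih =>
    have h : Differentiable ℝ fun x : P.Params =>
        (WithLp.toLp 2 (P.activation ξ x i.castSucc, x i.succ) :
          WithLp 2 (P.Act i.castSucc × P.Par i.succ)) :=
      (WithLp.prodContinuousLinearEquiv 2 ℝ _ _).symm.differentiable.comp (ih.prodMk (hproj i.succ))
    exact (hP.next i).2.1.comp h

/-- Differentiability of `loss` is not among the hypotheses; it is the tail at the first link that
is differentiable, hence the need for at least one link. -/
lemma differentiable_sampleLoss (hn : n ≠ 0) (ξ : Fin N) : Differentiable ℝ (P.sampleLoss ξ) := by
  let i : Fin n := ⟨0, Nat.pos_of_ne_zero hn⟩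
  have h : Differentiable ℝ fun x : P.Params =>
      (WithLp.toLp 2 (P.activation ξ x i.castSucc, x) : WithLp 2 (P.Act i.castSucc × P.Params)) :=
    (WithLp.prodContinuousLinearEquiv 2 ℝ _ _).symm.differentiable.comp
      ((hP.differentiable_activation ξ i.castSucc).prodMk differentiable_id)
  have e : P.sampleLoss ξ = fun x =>
      P.tailJoint i (WithLp.toLp 2 (P.activation ξ x i.castSucc, x)) :=
    funext fun x => P.sampleLoss_eq_tail ξ x i.castSucc
  rw [e]
  exact (hP.tail_lip i).1.comp h

lemma gradient_sampleLoss_block (hn : n ≠ 0) (ξ : Fin N) (x : P.Params) (j : Fin (n + 1)) :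
    gradient (P.sampleLoss ξ) x j = P.blockGradient ξ (P.exactMessages ξ x) x j := by
  rw [gradient_block (hP.differentiable_sampleLoss hn ξ x)]
  unfold blockGradient
  congr 1
  funext y
  exact P.sampleLoss_setBlock ξ x j y

lemma inner_gradient_objective (hn : n ≠ 0) (x v : P.Params) :
    inner ℝ (gradient P.objective x) v =
      (∑ ξ, inner ℝ (gradient (P.sampleLoss ξ) x) v) / N := by
  have h := (HasFDerivAt.fun_sum fun ξ (_ : ξ ∈ (Finset.univ : Finset (Fin N))) =>
    (hP.differentiable_sampleLoss hn ξ x).hasFDerivAt).const_smul (N : ℝ)⁻¹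
  have e : P.objective = fun x => (N : ℝ)⁻¹ • ∑ ξ, P.sampleLoss ξ x :=
    funext fun x => by rw [Pipeline.objective, smul_eq_mul, div_eq_inv_mul]
  have h' : fderiv ℝ P.objective x = (N : ℝ)⁻¹ • ∑ ξ, fderiv ℝ (P.sampleLoss ξ) x := by
    rw [e]; exact h.fderiv
  rw [inner_gradient_left, h']
  simp [div_eq_inv_mul, inner_gradient_left]

lemma sum_inner_gradient (hn : n ≠ 0) (x : P.Params) :
    (∑ ξ, -inner ℝ (gradient P.objective x) (gradient (P.sampleLoss ξ) x)) / N =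
      -‖gradient P.objective x‖ ^ 2 := by
  rw [← real_inner_self_eq_norm_sq, hP.inner_gradient_objective hn x (gradient P.objective x),
    Finset.sum_neg_distrib, neg_div]
  simp only [real_inner_comm]

/-- There are two sources of bias: the link gradient is taken at the message rather than at the
activation that was sent, and the incoming message is inexact. -/
lemma bias_castSucc (hn : n ≠ 0) (q : P.Quantizers S) (st : P.State) (d : Draw n N S) (i : Fin n) :
    bias q st d i.castSucc =
      (fderiv ℝ (P.machine d.1 (P.messages q st d) i.castSucc) (st.model i.castSucc)).adjoint
        (P.linkGradient i (P.messages q st d i) st.model -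
          P.linkGradient i (P.localActivation q st d i.castSucc) st.model) +
      (P.blockGradient d.1 (P.messages q st d) st.model i.castSucc -
        P.blockGradient d.1 (P.exactMessages d.1 st.model) st.model i.castSucc) := by
  simp only [bias, PiLp.sub_apply, noise_castSucc, hP.gradient_sampleLoss_block hn, update]
  rw [direction_castSucc, hP.blockGradient_castSucc d.1 (P.messages q st d),
    ← localActivation_eq_machine]
  simp only [map_sub]
  abel

lemma bias_last (hn : n ≠ 0) (q : P.Quantizers S) (st : P.State) (d : Draw n N S) :
    bias q st d (Fin.last n) = P.blockGradient d.1 (P.messages q st d) st.model (Fin.last n) -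
        P.blockGradient d.1 (P.exactMessages d.1 st.model) st.model (Fin.last n) := by
  simp only [bias, PiLp.sub_apply, noise_last, hP.gradient_sampleLoss_block hn, update]
  rw [direction_last, sub_zero]

/-- Both parts of the bias are differences of tail gradients, hence Lipschitz in the messages. The
factor `(100 * lipMax ^ 2) ^ n` in `biasFactor` is the cost of restoring the weights. -/
lemma norm_bias_sq_le (hn : n ≠ 0) (q : P.Quantizers S) (st : P.State) (d : Draw n N S) :
    ‖bias q st d‖ ^ 2 ≤ c.biasFactor * visitError c q st d := by
  set G : Fin (n + 1) → ℝ := fun j => ‖P.blockGradient d.1 (P.messages q st d) st.model j -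
        P.blockGradient d.1 (P.exactMessages d.1 st.model) st.model j‖ ^ 2 with hG
  set H : Fin n → ℝ := fun i => messageError q st d i + activationError q st d i.castSucc with hH
  have hcast : ∀ i : Fin n, ‖bias q st d i.castSucc‖ ^ 2 ≤
      4 * (c.boundMax ^ 2 * c.tailLipMax ^ 2) * H i + 2 * G i.castSucc := by
    intro i
    rw [hP.bias_castSucc hn]
    refine (norm_add_sq_le_two _ _).trans ?_
    have h1 : ‖(fderiv ℝ (P.machine d.1 (P.messages q st d) i.castSucc)
        (st.model i.castSucc)).adjoint (P.linkGradient i (P.messages q st d i) st.model -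
          P.linkGradient i (P.localActivation q st d i.castSucc) st.model)‖ ≤
        c.boundMax * (c.tailLipMax *
          ‖P.messages q st d i - P.localActivation q st d i.castSucc‖) := by
      refine (norm_adjoint_apply_le ((hP.norm_fderiv_machine_le _ _ _ _).trans
        (c.bound_le _)) _).trans ?_
      refine mul_le_mul_of_nonneg_left ((hP.norm_linkGradient_sub_le _ _ _ _).trans ?_)
        (zero_le_one.trans c.one_le_boundMax)
      exact mul_le_mul_of_nonneg_right (c.tailLip_le i) (norm_nonneg _)
    have h2 : ‖P.messages q st d i - P.localActivation q st d i.castSucc‖ ^ 2 ≤ 2 * H i := by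
      have e : P.messages q st d i - P.localActivation q st d i.castSucc =
          (P.messages q st d i - P.exactMessages d.1 st.model i) +
          (P.activation d.1 st.model i.castSucc - P.localActivation q st d i.castSucc) := by
        rw [exactMessages]; abel
      have := norm_add_sq_le_two (P.messages q st d i - P.exactMessages d.1 st.model i)
        (P.activation d.1 st.model i.castSucc - P.localActivation q st d i.castSucc)
      rw [← e, norm_sub_rev (P.activation d.1 st.model i.castSucc)] at this
      simp only [hH, messageError, activationError]
      linarith
    have h3 := pow_le_pow_left₀ (norm_nonneg _) h1 2
    have h4 : (c.boundMax * (c.tailLipMax *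
          ‖P.messages q st d i - P.localActivation q st d i.castSucc‖)) ^ 2 ≤
          (c.boundMax ^ 2 * c.tailLipMax ^ 2) * (2 * H i) := by
      rw [mul_pow, mul_pow, ← mul_assoc]
      exact mul_le_mul_of_nonneg_left h2 (by positivity)
    simp only [hG]
    linarith
  have hlast : ‖bias q st d (Fin.last n)‖ ^ 2 ≤ 2 * G (Fin.last n) := by
    rw [hP.bias_last hn]
    have : 0 ≤ G (Fin.last n) := sq_nonneg _
    simp only [hG] at this ⊢
    linarith
  have hsumG : ∑ j, G j ≤ c.tailLipMax ^ 2 * ∑ i : Fin n, messageError q st d i := by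
    rw [Fin.sum_univ_succ, Finset.mul_sum]
    -- The first machine reads the sample itself, so its block gradient involves no message.
    have h0 : G 0 = 0 := by simp [hG, P.blockGradient_zero d.1 _ (P.exactMessages d.1 st.model)]
    rw [h0, zero_add]
    refine Finset.sum_le_sum fun i _ => ?_
    simp only [hG, messageError]
    rw [← mul_pow]
    gcongr
    exact (hP.norm_blockGradient_succ_sub_le _ _ _ _ _).trans
      (mul_le_mul_of_nonneg_right (c.tailLip_le i) (norm_nonneg _))
  have hvisit : ∑ i : Fin n, messageError q st d i ≤
      (100 * c.lipMax ^ 2) ^ n * visitError c q st d := by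
    rw [visitError, Finset.mul_sum]
    refine Finset.sum_le_sum fun i _ => ?_
    rw [← mul_assoc]
    exact le_mul_of_one_le_left (messageError_nonneg _ _ _ _) (c.one_le_mul_weight i.2.le)
  have hsumH : ∑ i, H i ≤ (1 + c.lipMax ^ 2) * ∑ i : Fin n, messageError q st d i := by
    have := hP.sum_activationError_le q st d
    rw [hH, Finset.sum_add_distrib]
    linarith
  rw [PiLp.norm_sq_eq_of_L2, Fin.sum_univ_castSucc]
  have h1 := Finset.sum_le_sum fun i (_ : i ∈ Finset.univ) => hcast i
  rw [Finset.sum_add_distrib, ← Finset.mul_sum, ← Finset.mul_sum] at h1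
  rw [Fin.sum_univ_castSucc] at hsumG
  calc _ ≤ 4 * (c.boundMax ^ 2 * c.tailLipMax ^ 2) * ∑ i, H i +
        2 * (∑ i : Fin n, G i.castSucc + G (Fin.last n)) := by linarith
    _ ≤ 4 * (c.boundMax ^ 2 * c.tailLipMax ^ 2) *
          ((1 + c.lipMax ^ 2) * ∑ i : Fin n, messageError q st d i) +
        2 * (c.tailLipMax ^ 2 * ∑ i : Fin n, messageError q st d i) := by gcongr
    _ = (4 * c.boundMax ^ 2 * c.tailLipMax ^ 2 * (1 + c.lipMax ^ 2) + 2 * c.tailLipMax ^ 2) *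
          ∑ i : Fin n, messageError q st d i := by ring
    _ ≤ (4 * c.boundMax ^ 2 * c.tailLipMax ^ 2 * (1 + c.lipMax ^ 2) + 2 * c.tailLipMax ^ 2) *
          ((100 * c.lipMax ^ 2) ^ n * visitError c q st d) := by gcongr
    _ = _ := by rw [PipelineConstants.biasFactor]; ring

section Noise

variable [MeasurableSpace S] {ν : Measure S} {q : P.Quantizers S} {cQ : ℝ}
  (hq : ∀ i, IsUnbiasedQuantizer ν (q i) cQ)
include hq

lemma measurable_noise (st : P.State) : Measurable fun d : Draw n N S => noise q st d := by
  have hm : Measurable fun d : Draw n N S => P.messages q st d :=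
    hP.measurable_messages (fun i => (hq i).measurable) measurable_const measurable_id
  refine (WithLp.measurable_toLp 2 _).comp (measurable_pi_lambda _ fun j => ?_)
  induction j using Fin.lastCases with
  | last => simp
  | cast i =>
    simp only [Fin.lastCases_castSucc]
    have hl := hP.measurable_linkGradient i ((measurable_pi_apply i).comp hm)
      (measurable_const (a := st.model))
    exact measurable_adjoint_apply
      (hP.measurable_fderiv_machine _ measurable_fst hm measurable_const)
      (((hq i).measurable.comp (hl.prodMk
        ((measurable_pi_apply i).comp (measurable_snd.comp measurable_snd)))).sub hl)

variable [IsProbabilityMeasure ν]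

/-- Given the sample and the activation seeds, the messages are fixed and each link gradient is
quantized once. The links contribute to different blocks, so squared norms add without cross terms.
-/
lemma meanLE_noise (hN : 1 ≤ N) (st : P.State) :
    MeanLE (Pipeline.drawLaw n N ν) (fun d => ‖noise q st d‖ ^ 2) (cQ ^ 2 * c.cTildeSq) := by
  refine MeanLE.drawLaw hN ((hP.measurable_noise hq st).norm.pow_const 2) (fun d => sq_nonneg _)
    (g := fun _ _ => cQ ^ 2 * c.cTildeSq) (h := fun _ => cQ ^ 2 * c.cTildeSq) (fun ξ s => ?_)
    (fun ξ => MeanLE.const _) ?_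
  · set m := P.messages q st (ξ, s, s) with hm
    have hb : ∀ i t, ‖noise q st (ξ, s, t) i.castSucc‖ ^ 2 ≤ (c.bound i.castSucc : ℝ) ^ 2 *
        ‖P.linkGradient i (m i) st.model - q i (P.linkGradient i (m i) st.model) (t i)‖ ^ 2 := by
      intro i t
      rw [noise_castSucc, norm_sub_rev, ← mul_pow]
      exact pow_le_pow_left₀ (norm_nonneg _)
        (norm_adjoint_apply_le (hP.norm_fderiv_machine_le _ _ _ _) _) 2
    have hi : ∀ i : Fin n, MeanLE (Measure.pi fun _ : Fin n => ν) (fun t =>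
        ‖P.linkGradient i (m i) st.model - q i (P.linkGradient i (m i) st.model) (t i)‖ ^ 2)
        (cQ ^ 2 * c.tailBound i ^ 2) := by
      intro i
      have hint := (hq i).integrable_sq (P.linkGradient i (m i) st.model)
      refine ⟨integrable_comp_eval (μ := fun _ : Fin n => ν) (i := i) hint, ?_⟩
      rw [integral_comp_eval (μ := fun _ : Fin n => ν) (i := i) hint.aestronglyMeasurable]
      refine ((hq i).error_le _).trans ?_
      gcongr
      exact hP.norm_linkGradient_le i _ _
    refine ((MeanLE.sum Finset.univ fun i _ =>
      (hi i).const_mul (sq_nonneg (c.bound i.castSucc : ℝ))).mono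
      (((hP.measurable_noise hq st).norm.pow_const 2).comp
        (measurable_const.prodMk (measurable_const.prodMk measurable_id)))
      (fun _ => sq_nonneg _) fun t => ?_).weaken ?_
    · change ‖noise q st (ξ, s, t)‖ ^ 2 ≤ _
      rw [PiLp.norm_sq_eq_of_L2, Fin.sum_univ_castSucc, noise_last]
      simp only [norm_zero, ne_eq, OfNat.ofNat_ne_zero, not_false_eq_true, zero_pow, add_zero]
      exact Finset.sum_le_sum fun i _ => hb i t
    · rw [PipelineConstants.cTildeSq, Finset.mul_sum]
      exact (Finset.sum_congr rfl fun i _ => by ring).le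
  · rw [Finset.sum_const, Finset.card_univ, Fintype.card_fin, nsmul_eq_mul,
      mul_div_cancel_left₀]
    exact_mod_cast (Nat.pos_of_ne_zero (by omega)).ne'

/-- With the messages fixed, moving the adjoint to the other side leaves a linear function of the
quantization errors, whose means vanish by unbiasedness. The bound on the second moment gives
integrability. -/
lemma meanLE_inner_noise (hN : 1 ≤ N) (st : P.State) (v : P.Params) :
    MeanLE (Pipeline.drawLaw n N ν) (fun d => -inner ℝ v (noise q st d)) 0 := by
  have := isProbabilityMeasure_drawLaw (n := n) (ν := ν) hN
  refine MeanLE.drawLaw_zero hN (measurable_const.inner (hP.measurable_noise hq st)).neg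
    ((MeanLE.const (‖v‖ ^ 2)).add (hP.meanLE_noise hq hN st)) (fun d => ?_) fun ξ s => ?_
  · rw [abs_neg]
    refine (abs_real_inner_le_norm _ _).trans ?_
    nlinarith [sq_nonneg (‖v‖ - ‖noise q st d‖), sq_nonneg ‖v‖, sq_nonneg ‖noise q st d‖]
  · rw [integral_neg, neg_eq_zero]
    set m := P.messages q st (ξ, s, s) with hm
    set w : ∀ i : Fin n, P.Act i.castSucc := fun i =>
      fderiv ℝ (P.machine ξ m i.castSucc) (st.model i.castSucc) (v i.castSucc) with hw
    set h : ∀ i : Fin n, P.Act i.castSucc := fun i => P.linkGradient i (m i) st.model with hh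
    have e : ∀ t, inner ℝ v (noise q st (ξ, s, t)) = ∑ i, inner ℝ (w i) (q i (h i) (t i) - h i) := by
      intro t
      rw [PiLp.inner_apply, Fin.sum_univ_castSucc, noise_last, inner_zero_right, add_zero]
      refine Finset.sum_congr rfl fun i _ => ?_
      rw [noise_castSucc, ContinuousLinearMap.adjoint_inner_right]
      rfl
    have hint : ∀ i, Integrable (fun y => q i (h i) y - h i) ν := fun i =>
      ((hq i).integrable (h i)).sub (integrable_const _)
    have hint' : ∀ i, Integrable (fun y => inner ℝ (w i) (q i (h i) y - h i)) ν := fun i =>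
      (hint i).const_inner (w i)
    simp only [e]
    rw [integral_finsetSum _ fun i _ =>
      integrable_comp_eval (μ := fun _ : Fin n => ν) (i := i) (hint' i)]
    refine Finset.sum_eq_zero fun i _ => ?_
    rw [integral_comp_eval (μ := fun _ : Fin n => ν) (i := i) (hint' i).aestronglyMeasurable,
      integral_inner (hint i), integral_sub ((hq i).integrable (h i)) (integrable_const _),
      (hq i).unbiased]
    simp

end Noise

end LipschitzAssumptions

end Pipeline

/-! ### Drift of the Lyapunov function -/

namespace PipelineConstants

variable {n : ℕ} (c : PipelineConstants n)

/-- The factor between the squared motion of the model and the error that it causes in all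
buffers. -/
def motionFactor (N : ℕ) : ℝ := N * (n * ((2 * c.lipMax) ^ n) ^ 2)

lemma motionFactor_nonneg (N : ℕ) : 0 ≤ c.motionFactor N := by unfold motionFactor; positivity

/-- The weight of the buffer errors in the Lyapunov function, in units of the learning rate. -/
def errorWeight (N : ℕ) : ℝ := 10 * N * c.biasFactor

lemma errorWeight_nonneg (N : ℕ) : 0 ≤ c.errorWeight N := by
  have := c.biasFactor_nonneg
  unfold errorWeight; positivity

/-- The coefficient of the cubic term of the drift of the Lyapunov function. -/
def driftFactor (N : ℕ) : ℝ := c.errorWeight N * ((1 + 10 * N) * c.motionFactor N)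

lemma driftFactor_nonneg (N : ℕ) : 0 ≤ c.driftFactor N := by
  have := c.errorWeight_nonneg N
  have := c.motionFactor_nonneg N
  unfold driftFactor; positivity

end PipelineConstants

lemma norm_sum_four_sq_le {E : Type*} [SeminormedAddCommGroup E] (a b c d : E) :
    ‖a + b + c + d‖ ^ 2 ≤ 4 * (‖a‖ ^ 2 + ‖b‖ ^ 2 + ‖c‖ ^ 2 + ‖d‖ ^ 2) := by
  have h : ‖a + b + c + d‖ ≤ ‖a‖ + ‖b‖ + ‖c‖ + ‖d‖ :=
    (norm_add_le _ _).trans (add_le_add_left (norm_add₃_le) _)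
  have := pow_le_pow_left₀ (norm_nonneg _) h 2
  nlinarith [sq_nonneg (‖a‖ - ‖b‖), sq_nonneg (‖a‖ - ‖c‖), sq_nonneg (‖a‖ - ‖d‖),
    sq_nonneg (‖b‖ - ‖c‖), sq_nonneg (‖b‖ - ‖d‖), sq_nonneg (‖c‖ - ‖d‖)]

namespace Pipeline

variable {n N : ℕ} {P : Pipeline n N} {S : Type*}

lemma step_model (q : P.Quantizers S) (γ : ℝ) (st : P.State) (d : Draw n N S) :
    (P.step q γ st d).model = st.model - γ • update q st d := rfl

/-- The Lyapunov function: the objective gap plus the weighted errors of the buffers. -/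
def lyapunov (c : PipelineConstants n) (γ : ℝ) (st : P.State) : ℝ :=
  P.objective st.model - (⨅ x, P.objective x) + c.errorWeight N * γ * totalError c st

lemma totalError_initState (c : PipelineConstants n) (x : P.Params) :
    totalError c (P.initState x) = 0 := by
  simp [totalError, sampleError, bufferError, initState]

lemma lyapunov_nonneg (hb : BddBelow (Set.range P.objective)) (c : PipelineConstants n) {γ : ℝ}
    (hγ : 0 ≤ γ) (st : P.State) : 0 ≤ lyapunov c γ st := by
  have h1 := ciInf_le hb st.model
  have h2 := mul_nonneg (mul_nonneg (c.errorWeight_nonneg N) hγ) (totalError_nonneg c st)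
  unfold lyapunov; linarith

namespace LipschitzAssumptions

variable {Lf : ℝ≥0} {c : PipelineConstants n} (hP : P.LipschitzAssumptions Lf c)
include hP

/-- Each machine sees a change of its input and of its own block. Since `lipMax ≥ 1`, the second is
dominated by the bound for the first, so each machine costs a factor `2 * lipMax`. -/
lemma norm_activation_sub_le (ξ : Fin N) (x y : P.Params) (j : Fin (n + 1)) :
    ‖P.activation ξ x j - P.activation ξ y j‖ ≤ (2 * c.lipMax) ^ (j + 1 : ℕ) * ‖x - y‖ := by
  have hl := c.one_le_lipMax
  have hb : ∀ j, ‖x j - y j‖ ≤ ‖x - y‖ := fun j => PiLp.norm_apply_le (x - y) j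
  induction j using Fin.induction with
  | zero =>
    refine ((hP.first ξ).1.norm_sub_le _ _).trans ?_
    refine mul_le_mul ?_ (hb 0) (norm_nonneg _) (by positivity)
    have := c.lip_le 0
    simp only [Fin.val_zero, zero_add, pow_one]
    linarith
  | succ i ih =>
    rw [activation_succ, activation_succ]
    refine ((hP.next i).1.norm_sub_le _ _).trans ?_
    rw [← WithLp.toLp_sub, Prod.mk_sub_mk]
    have h1 := norm_toLp_le (P.activation ξ x i.castSucc - P.activation ξ y i.castSucc)
      (x i.succ - y i.succ)
    have h2 := hb i.succ
    have hpow : 1 ≤ (2 * c.lipMax) ^ (i + 1 : ℕ) := one_le_pow₀ (by linarith)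
    simp only [Fin.val_castSucc] at ih
    calc _ ≤ c.lipMax * ((2 * c.lipMax) ^ (i + 1 : ℕ) * ‖x - y‖ + ‖x - y‖) := by
          refine mul_le_mul (c.lip_le _) (by linarith) (norm_nonneg _) (by linarith)
      _ ≤ c.lipMax * ((2 * c.lipMax) ^ (i + 1 : ℕ) * ‖x - y‖ +
            (2 * c.lipMax) ^ (i + 1 : ℕ) * ‖x - y‖) := by
          gcongr
          exact le_mul_of_one_le_left (norm_nonneg _) hpow
      _ = _ := by rw [Fin.val_succ, pow_succ (2 * c.lipMax) (i + 1)]; ring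

lemma norm_exactMessages_sub_sq_le (ξ : Fin N) (x y : P.Params) (i : Fin n) :
    ‖P.exactMessages ξ x i - P.exactMessages ξ y i‖ ^ 2 ≤ ((2 * c.lipMax) ^ n) ^ 2 * ‖x - y‖ ^ 2 := by
  have hl := c.one_le_lipMax
  rw [← mul_pow]
  refine pow_le_pow_left₀ (norm_nonneg _) ((hP.norm_activation_sub_le ξ x y i.castSucc).trans ?_) 2
  gcongr
  · linarith
  · exact i.2

/-- The motion of the model increases the squared error of a message. -/
lemma norm_sub_exactMessages_sq_le {β : ℝ} (hβ : 0 < β) (ξ : Fin N) (m : P.Messages) (x v : P.Params)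
    (i : Fin n) : ‖m i - P.exactMessages ξ (x - v) i‖ ^ 2 ≤ (1 + β) * ‖m i - P.exactMessages ξ x i‖ ^ 2 +
      (1 + 1 / β) * (((2 * c.lipMax) ^ n) ^ 2 * ‖v‖ ^ 2) := by
  have h := norm_add_sq_le_young (m i - P.exactMessages ξ x i) (P.exactMessages ξ x i - P.exactMessages ξ (x - v) i) hβ
  rw [sub_add_sub_cancel] at h
  have h2 := hP.norm_exactMessages_sub_sq_le ξ x (x - v) i
  rw [sub_sub_cancel] at h2
  have : 0 ≤ 1 + 1 / β := by positivity
  nlinarith [mul_le_mul_of_nonneg_left h2 this]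

/-- One step increases the total error of the buffers at most by the motion of the model, while the
error of the visited sample is replaced by that of the current messages. -/
lemma totalError_step_le (q : P.Quantizers S) (γ : ℝ) {β : ℝ} (hβ : 0 < β) (st : P.State)
    (d : Draw n N S) : totalError c (P.step q γ st d) ≤
      (1 + β) * (totalError c st - sampleError c st d.1 + visitError c q st d) +
        (1 + 1 / β) * (c.motionFactor N * ‖γ • update q st d‖ ^ 2) := by
  set v := γ • update q st d with hv
  set M := (1 + 1 / β) * (((2 * c.lipMax) ^ n) ^ 2 * ‖v‖ ^ 2) with hM
  have hM0 : 0 ≤ M := by positivity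
  set E : Fin N → Fin n → ℝ := fun ξ i =>
    if ξ = d.1 then messageError q st d i else bufferError st ξ i with hE
  have key : ∀ ξ i, bufferError (P.step q γ st d) ξ i ≤ (1 + β) * E ξ i + M := by
    intro ξ i
    by_cases h : ξ = d.1
    · subst h
      have e : bufferError (P.step q γ st d) d.1 i =
          ‖P.messages q st d i - P.exactMessages d.1 (st.model - v) i‖ ^ 2 := by
        simp [bufferError, step, hv, update]
      rw [e]
      simp only [hE, if_true]
      exact hP.norm_sub_exactMessages_sq_le hβ d.1 _ st.model v i
    · have e : bufferError (P.step q γ st d) ξ i =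
          if st.seen ξ then ‖st.buffer ξ i - P.exactMessages ξ (st.model - v) i‖ ^ 2 else 0 := by
        simp [bufferError, step, hv, update, Function.update_of_ne h]
      rw [e]
      simp only [hE, if_neg h, bufferError]
      split_ifs
      · exact hP.norm_sub_exactMessages_sq_le hβ ξ _ st.model v i
      · simpa using hM0
  have hsample : ∀ ξ, sampleError c (P.step q γ st d) ξ ≤
      (1 + β) * (∑ i : Fin n, c.weight i * E ξ i) + n * M := by
    intro ξ
    have : (n : ℝ) * M = ∑ _i : Fin n, M := by simp
    rw [this, Finset.mul_sum, ← Finset.sum_add_distrib]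
    refine Finset.sum_le_sum fun i _ => ?_
    have h1 := mul_le_mul_of_nonneg_left (key ξ i) (c.weight_pos i).le
    have h2 := mul_le_of_le_one_left hM0 (c.weight_le_one i)
    linarith
  have hsumE : ∑ ξ, ∑ i : Fin n, c.weight i * E ξ i =
      totalError c st - sampleError c st d.1 + visitError c q st d := by
    rw [totalError, ← Finset.add_sum_erase _ _ (Finset.mem_univ d.1),
      ← Finset.add_sum_erase _ (fun ξ => sampleError c st ξ) (Finset.mem_univ d.1)]
    have h1 : ∑ i : Fin n, c.weight i * E d.1 i = visitError c q st d := by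
      simp [hE, visitError]
    have h2 : ∑ ξ ∈ Finset.univ.erase d.1, ∑ i : Fin n, c.weight i * E ξ i =
        ∑ ξ ∈ Finset.univ.erase d.1, sampleError c st ξ := by
      refine Finset.sum_congr rfl fun ξ hξ => ?_
      simp only [hE, if_neg (Finset.ne_of_mem_erase hξ), sampleError]
    rw [h1, h2]; ring
  calc totalError c (P.step q γ st d)
      ≤ ∑ ξ : Fin N, ((1 + β) * (∑ i : Fin n, c.weight i * E ξ i) + n * M) :=
        Finset.sum_le_sum fun ξ _ => hsample ξ
    _ = _ := by
        rw [Finset.sum_add_distrib, ← Finset.mul_sum, hsumE]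
        simp only [Finset.sum_const, Finset.card_univ, Fintype.card_fin, nsmul_eq_mul,
          PipelineConstants.motionFactor, hM]
        ring

lemma measurable_totalError : Measurable fun st : P.State => totalError c st := by
  refine Finset.measurable_fun_sum _ fun ξ _ => Finset.measurable_fun_sum _ fun i _ =>
    Measurable.const_mul (Measurable.ite ?_ ?_ measurable_const) _
  · exact measurable_seen ξ (measurableSet_singleton true)
  · exact ((((measurable_pi_apply i).comp (measurable_buffer ξ)).sub
      ((hP.measurable_activation ξ i.castSucc).comp measurable_model)).norm).pow_const 2

lemma measurable_lyapunov (γ : ℝ) : Measurable fun st : P.State => lyapunov c γ st :=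
  ((hP.objective.1.continuous.measurable.comp measurable_model).sub_const _).add
    (hP.measurable_totalError.const_mul _)

section Drift

variable [MeasurableSpace S] {ν : Measure S} [IsProbabilityMeasure ν] {q : P.Quantizers S} {cQ : ℝ}
  (hq : ∀ i, IsUnbiasedQuantizer ν (q i) cQ)
include hq

lemma meanLE_visitError_draw (hN : 1 ≤ N) (hcQ : cQ ^ 2 ≤ 1 / 2) (st : P.State) :
    MeanLE (drawLaw n N ν) (fun d => visitError c q st d) (totalError c st) := by
  have hN' : (0 : ℝ) < N := by exact_mod_cast hN
  refine MeanLE.drawLaw hN (hP.measurable_visitError hq st) (fun d => visitError_nonneg _ _ _ _)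
    (fun ξ s => MeanLE.const (visitError c q st (ξ, s, s)))
    (fun ξ => hP.meanLE_visitError hq hcQ st ξ) ?_
  rw [← Finset.mul_sum, ← totalError, div_le_iff₀ hN']
  have h1 := totalError_nonneg c st
  have h2 : (1 : ℝ) ≤ N := by exact_mod_cast hN
  nlinarith

/-- Each sample is drawn with probability `1 / N`, and its error is then multiplied by at most `4 /
5`: in mean a fraction `1 / (5 * N)` of the total disappears. -/
lemma meanLE_newError (hN : 1 ≤ N) (hcQ : cQ ^ 2 ≤ 1 / 2) (st : P.State) :
    MeanLE (drawLaw n N ν) (fun d => totalError c st - sampleError c st d.1 + visitError c q st d)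
      ((1 - 1 / (5 * N)) * totalError c st) := by
  have hN' : (0 : ℝ) < N := by exact_mod_cast hN
  refine MeanLE.drawLaw hN ?_ (fun d => ?_)
    (fun ξ s => MeanLE.const (totalError c st - sampleError c st ξ + visitError c q st (ξ, s, s)))
    (fun ξ => (MeanLE.const _).add (hP.meanLE_visitError hq hcQ st ξ)) ?_
  · exact (measurable_const.sub ((measurable_of_finite (sampleError c st)).comp
      measurable_fst)).add (hP.measurable_visitError hq st)
  · have h1 := sampleError_le_totalError c st d.1
    have h2 := visitError_nonneg c q st d
    linarith
  · rw [Finset.sum_add_distrib, Finset.sum_sub_distrib, ← Finset.mul_sum, ← totalError]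
    simp only [Finset.sum_const, Finset.card_univ, Fintype.card_fin, nsmul_eq_mul]
    apply le_of_eq
    field_simp
    ring

/-- The drift of the Lyapunov function in one step. -/
lemma meanLE_lyapunov_step (hn : n ≠ 0) (hN : 1 ≤ N) (hcQ : cQ ^ 2 ≤ 1 / 2)
    (hb : BddBelow (Set.range P.objective)) {σ : ℝ} (hσ : P.BoundedVariance σ) {γ : ℝ}
    (hγ : 0 < γ) (hγ' : Lf * γ + c.driftFactor N * γ ^ 2 ≤ 1 / 16) (st : P.State) :
    MeanLE (drawLaw n N ν) (fun d => lyapunov c γ (P.step q γ st d))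
      (lyapunov c γ st - γ / 4 * ‖gradient P.objective st.model‖ ^ 2 +
        4 * γ * (Lf * γ + c.driftFactor N * γ ^ 2) * (σ ^ 2 + cQ ^ 2 * c.cTildeSq)) := by
  have := isProbabilityMeasure_drawLaw (n := n) (ν := ν) hN
  have hN' : (1 : ℝ) ≤ N := by exact_mod_cast hN
  set x := st.model with hx
  set g := gradient P.objective x with hg
  set κ := Lf * γ + c.driftFactor N * γ ^ 2 with hκ
  have hκ0 : 0 ≤ κ := by have := c.driftFactor_nonneg N; positivity
  have ha := c.errorWeight_nonneg N
  set a := c.errorWeight N with ha'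
  -- The Young parameter is half of the contraction `1 / (5 * N)`, so that the motion of the model
  -- spoils only half of it.
  set β : ℝ := 1 / (10 * N) with hβ
  have hβ0 : 0 < β := by positivity
  have hpoint : ∀ d : Draw n N S, lyapunov c γ (P.step q γ st d) ≤
      (P.objective x - (⨅ x, P.objective x) + γ / 2 * ‖g‖ ^ 2 + 4 * γ * κ * ‖g‖ ^ 2) +
      γ * (-inner ℝ g (gradient (P.sampleLoss d.1) x)) +
      γ * (-inner ℝ g (noise q st d)) +
      4 * γ * κ * ‖gradient (P.sampleLoss d.1) x - g‖ ^ 2 +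
      4 * γ * κ * ‖noise q st d‖ ^ 2 +
      (γ / 2 + 4 * γ * κ) * c.biasFactor * visitError c q st d +
      a * γ * (1 + β) * (totalError c st - sampleError c st d.1 + visitError c q st d) := by
    intro d
    have h1 := hP.objective.le_add x (-(γ • update q st d))
    rw [← sub_eq_add_neg, inner_neg_right, norm_neg, norm_smul, Real.norm_of_nonneg hγ.le,
      inner_smul_right, mul_pow, ← hg] at h1
    have h2 := hP.totalError_step_le q γ hβ0 st d
    rw [norm_smul, Real.norm_of_nonneg hγ.le, mul_pow] at h2
    have h3 : ‖update q st d‖ ^ 2 ≤ 4 * (‖g‖ ^ 2 + ‖gradient (P.sampleLoss d.1) x - g‖ ^ 2 +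
        ‖bias q st d‖ ^ 2 + ‖noise q st d‖ ^ 2) := by
      have e : update q st d = g + (gradient (P.sampleLoss d.1) x - g) + bias q st d +
          noise q st d := by rw [update_eq]; abel
      rw [e]
      exact norm_sum_four_sq_le _ _ _ _
    have h4 := hP.norm_bias_sq_le hn q st d
    have h5 : inner ℝ g (update q st d) = inner ℝ g (gradient (P.sampleLoss d.1) x) +
        inner ℝ g (bias q st d) + inner ℝ g (noise q st d) := by
      rw [update_eq, inner_add_right, inner_add_right]
    -- The bias has no sign or mean to exploit: half of the descent `γ ‖g‖²` is given up for it.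
    have h6 : -inner ℝ g (bias q st d) ≤ 1 / 2 * ‖g‖ ^ 2 + 1 / 2 * ‖bias q st d‖ ^ 2 := by
      have := (neg_le_abs _).trans (abs_real_inner_le_norm g (bias q st d))
      nlinarith [sq_nonneg (‖g‖ - ‖bias q st d‖)]
    have h7 := mul_le_mul_of_nonneg_left h2 (mul_nonneg ha hγ.le)
    -- The quadratic term of the descent lemma and the error caused by the motion are collected into
    -- `γ * κ`, where `1 + 1 / β = 1 + 10 * N`.
    have e8 : a * γ * ((1 + 1 / β) * (c.motionFactor N * (γ ^ 2 * ‖update q st d‖ ^ 2))) +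
        Lf * (γ ^ 2 * ‖update q st d‖ ^ 2) = γ * κ * ‖update q st d‖ ^ 2 := by
      rw [hκ, PipelineConstants.driftFactor, ← ha', hβ, one_div_one_div]
      ring
    have h9 := mul_le_mul_of_nonneg_left h3 (mul_nonneg hγ.le hκ0)
    have h10 := mul_le_mul_of_nonneg_left h4 (show 0 ≤ γ / 2 + 4 * γ * κ by positivity)
    have h11 := mul_le_mul_of_nonneg_left h6 hγ.le
    rw [h5] at h1
    unfold lyapunov
    rw [step_model, ← hx, ← ha']
    linarith
  have hmg : MeanLE (drawLaw n N ν) (fun d => -inner ℝ g (gradient (P.sampleLoss d.1) x))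
      (-‖g‖ ^ 2) := MeanLE.drawLaw_sample hN (hP.sum_inner_gradient hn x).le
  have hmv : MeanLE (drawLaw n N ν) (fun d => ‖gradient (P.sampleLoss d.1) x - g‖ ^ 2) (σ ^ 2) :=
    MeanLE.drawLaw_sample (f := fun ξ => ‖gradient (P.sampleLoss ξ) x - g‖ ^ 2) hN (hσ x)
  have hC := c.biasFactor_nonneg
  have hmean := ((((((MeanLE.const (μ := drawLaw n N ν) (P.objective x - (⨅ x, P.objective x) +
    γ / 2 * ‖g‖ ^ 2 + 4 * γ * κ * ‖g‖ ^ 2)).add (hmg.const_mul hγ.le)).add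
    ((hP.meanLE_inner_noise hq hN st g).const_mul hγ.le)).add
    (hmv.const_mul (a := 4 * γ * κ) (by positivity))).add
    ((hP.meanLE_noise hq hN st).const_mul (a := 4 * γ * κ) (by positivity))).add
    ((hP.meanLE_visitError_draw hq hN hcQ st).const_mul
      (a := (γ / 2 + 4 * γ * κ) * c.biasFactor) (by positivity))).add
    ((hP.meanLE_newError hq hN hcQ st).const_mul (a := a * γ * (1 + β)) (by positivity))
  refine (hmean.mono ((hP.measurable_lyapunov γ).comp
    ((hP.measurable_step (fun i => (hq i).measurable) hn γ).comp measurable_prodMk_left))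
    (fun d => lyapunov_nonneg hb c hγ.le _) hpoint).weaken ?_
  -- Remaining bookkeeping: since `(1 + β) * (1 - 2 * β) ≤ 1 - β` and `a * β = biasFactor`, the
  -- buffer term drops by `γ * biasFactor * totalError`. With `κ ≤ 1 / 16` this covers the bias, and
  -- `4 * γ * κ ≤ γ / 4` leaves `γ - γ / 2 - γ / 4 = γ / 4` in front of `‖g‖²`.
  have hW := totalError_nonneg c st
  have e1 : a * γ * (1 + β) * ((1 - 1 / (5 * N)) * totalError c st) ≤
      a * γ * totalError c st - γ * c.biasFactor * totalError c st := by
    have h1 : (1 + β) * (1 - 1 / (5 * N)) ≤ 1 - β := by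
      have : 1 / (5 * (N : ℝ)) = 2 * β := by rw [hβ]; field_simp; norm_num
      rw [this]; nlinarith
    have h2 : a * β = c.biasFactor := by
      rw [ha', PipelineConstants.errorWeight, hβ]; field_simp
    have h3 := mul_le_mul_of_nonneg_left h1
      (mul_nonneg (mul_nonneg ha hγ.le) hW)
    calc _ = a * γ * totalError c st * ((1 + β) * (1 - 1 / (5 * N))) := by ring
      _ ≤ _ := h3
      _ = a * γ * totalError c st - γ * (a * β) * totalError c st := by ring
      _ = _ := by rw [h2]
  have e2 : (γ / 2 + 4 * γ * κ) * c.biasFactor * totalError c st ≤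
      γ * c.biasFactor * totalError c st := by
    gcongr
    nlinarith
  have e3 : 4 * γ * κ * ‖g‖ ^ 2 ≤ γ / 4 * ‖g‖ ^ 2 := by
    gcongr
    nlinarith
  unfold lyapunov
  rw [← hx, ← ha']
  linarith

end Drift

end LipschitzAssumptions

end Pipeline

/-! ### Telescoping along the run -/

namespace Pipeline

variable {n N : ℕ} {P : Pipeline n N} {S : Type*} [MeasurableSpace S]

namespace LipschitzAssumptions

variable {Lf : ℝ≥0} {c : PipelineConstants n} (hP : P.LipschitzAssumptions Lf c)
include hP

section Run

variable {q : P.Quantizers S} (hq : ∀ i, Measurable (Function.uncurry (q i)))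
include hq

/-- The state after `t` iterations is a measurable function of the first `t` draws. -/
lemma exists_measurable_run_eq (hn : n ≠ 0) (γ : ℝ) (x₁ : P.Params) (t : ℕ) :
    ∃ ψ : (Finset.range t → Draw n N S) → P.State, Measurable ψ ∧
      ∀ D : ℕ → Draw n N S, P.run q γ x₁ D t = ψ fun i => D i := by
  induction t with
  | zero => exact ⟨fun _ => P.initState x₁, measurable_const, fun D => rfl⟩
  | succ t ih =>
    obtain ⟨ψ, hψ, h⟩ := ih
    refine ⟨fun g => P.step q γ
      (ψ fun i => g ⟨i, Finset.range_subset_range.2 t.le_succ i.2⟩)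
      (g ⟨t, Finset.self_mem_range_succ t⟩), ?_, fun D => ?_⟩
    · exact (hP.measurable_step hq hn γ).comp ((hψ.comp (measurable_pi_lambda _ fun i =>
        measurable_pi_apply _)).prodMk (measurable_pi_apply _))
    · rw [run, h]

variable {Ω : Type*} [MeasurableSpace Ω] {μ : Measure Ω} {D : ℕ → Ω → Draw n N S}

lemma aemeasurable_run (hn : n ≠ 0) (hD : ∀ t, AEMeasurable (D t) μ) (γ : ℝ) (x₁ : P.Params)
    (t : ℕ) : AEMeasurable (fun ω => P.run q γ x₁ (fun s => D s ω) t) μ := by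
  obtain ⟨ψ, hψ, h⟩ := hP.exists_measurable_run_eq hq hn γ x₁ t
  simp only [h]
  exact hψ.comp_aemeasurable (aemeasurable_pi_lambda _ fun i => hD i)

lemma indepFun_run (hn : n ≠ 0) (hind : iIndepFun D μ) (hD : ∀ t, AEMeasurable (D t) μ) (γ : ℝ)
    (x₁ : P.Params) (t : ℕ) :
    IndepFun (fun ω => P.run q γ x₁ (fun s => D s ω) t) (D t) μ := by
  obtain ⟨ψ, hψ, h⟩ := hP.exists_measurable_run_eq hq hn γ x₁ t
  simp only [h]
  exact (hind.indepFun_finset₀ (Finset.range t) {t} (by simp) hD).comp hψ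
    (measurable_pi_apply (⟨t, Finset.mem_singleton_self t⟩ : ({t} : Finset ℕ)))

end Run

section Main

variable {ν : Measure S} [IsProbabilityMeasure ν] {q : P.Quantizers S} {cQ : ℝ}
  (hq : ∀ i, IsUnbiasedQuantizer ν (q i) cQ)
  {Ω : Type*} [MeasurableSpace Ω] {μ : Measure Ω} [IsProbabilityMeasure μ]
  {D : ℕ → Ω → Draw n N S}
include hq

/-- The expected drift of the Lyapunov function along the run. -/
lemma integral_lyapunov_run_succ (hn : n ≠ 0) (hN : 1 ≤ N) (hcQ : cQ ^ 2 ≤ 1 / 2)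
    (hb : BddBelow (Set.range P.objective)) {σ : ℝ} (hσ : P.BoundedVariance σ)
    (hind : iIndepFun D μ) (hD : ∀ t, HasLaw (D t) (drawLaw n N ν) μ) {γ : ℝ} (hγ : 0 < γ)
    (hγ' : Lf * γ + c.driftFactor N * γ ^ 2 ≤ 1 / 16) (x₁ : P.Params) (t : ℕ)
    (hi : Integrable (fun ω => lyapunov c γ (P.run q γ x₁ (fun s => D s ω) t)) μ) :
    Integrable (fun ω => ‖gradient P.objective (P.run q γ x₁ (fun s => D s ω) t).model‖ ^ 2) μ ∧
    MeanLE μ (fun ω => lyapunov c γ (P.run q γ x₁ (fun s => D s ω) (t + 1)))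
      (∫ ω, lyapunov c γ (P.run q γ x₁ (fun s => D s ω) t) ∂μ -
        γ / 4 * ∫ ω, ‖gradient P.objective (P.run q γ x₁ (fun s => D s ω) t).model‖ ^ 2 ∂μ +
        4 * γ * (Lf * γ + c.driftFactor N * γ ^ 2) * (σ ^ 2 + cQ ^ 2 * c.cTildeSq)) := by
  have := isProbabilityMeasure_drawLaw (n := n) (ν := ν) hN
  have hqm := fun i => (hq i).measurable
  set B := 4 * γ * (Lf * γ + c.driftFactor N * γ ^ 2) * (σ ^ 2 + cQ ^ 2 * c.cTildeSq) with hB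
  set X : Ω → P.State := fun ω => P.run q γ x₁ (fun s => D s ω) t with hX
  have hXm : AEMeasurable X μ := hP.aemeasurable_run hqm hn (fun t => (hD t).aemeasurable) γ x₁ t
  have : IsProbabilityMeasure (μ.map X) := Measure.isProbabilityMeasure_map hXm
  -- The state at time `t` is a function of earlier draws, so it is independent of `D t` and the
  -- one-step drift can be integrated over a product law.
  have hlaw : μ.map (fun ω => (X ω, D t ω)) = (μ.map X).prod (drawLaw n N ν) := by
    rw [← (hD t).map_eq]
    exact (indepFun_iff_map_prod_eq_prod_map_map hXm (hD t).aemeasurable).1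
      (hP.indepFun_run hqm hn hind (fun t => (hD t).aemeasurable) γ x₁ t)
  have hstep := hP.meanLE_lyapunov_step hq hn hN hcQ hb hσ hγ hγ'
  have hgm : Measurable fun st : P.State => ‖gradient P.objective st.model‖ ^ 2 :=
    (((measurable_gradient P.objective).comp measurable_model).norm).pow_const 2
  have hlm := hP.measurable_lyapunov γ
  have hi' : Integrable (lyapunov c γ) (μ.map X) :=
    (integrable_map_measure hlm.aestronglyMeasurable hXm).2 hi
  -- Square integrability of the gradient comes from the drift itself: the Lyapunov function stays
  -- nonnegative after the step, so `γ / 4 * ‖∇f‖²` is at most its current value plus `B`.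
  have hg' : Integrable (fun st : P.State => ‖gradient P.objective st.model‖ ^ 2) (μ.map X) := by
    refine (((MeanLE.add ⟨hi', le_rfl⟩ (MeanLE.const B)).const_mul (a := 4 / γ)
      (by positivity)).mono hgm (fun _ => sq_nonneg _) fun st => ?_).1
    have h0 : 0 ≤ lyapunov c γ st - γ / 4 * ‖gradient P.objective st.model‖ ^ 2 + B :=
      (integral_nonneg fun d => lyapunov_nonneg hb c hγ.le _).trans (hstep st).2
    have h1 : ‖gradient P.objective st.model‖ ^ 2 =
        4 / γ * (γ / 4 * ‖gradient P.objective st.model‖ ^ 2) := by field_simp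
    rw [h1]
    exact mul_le_mul_of_nonneg_left (by linarith) (by positivity)
  have hg : Integrable (fun ω => ‖gradient P.objective (X ω).model‖ ^ 2) μ :=
    (integrable_map_measure hgm.aestronglyMeasurable hXm).1 hg'
  refine ⟨hg, ?_⟩
  have hcomp : Measurable fun p : P.State × Draw n N S => lyapunov c γ (P.step q γ p.1 p.2) :=
    hlm.comp (hP.measurable_step hqm hn γ)
  have hprod : MeanLE ((μ.map X).prod (drawLaw n N ν))
      (fun p => lyapunov c γ (P.step q γ p.1 p.2))
      (∫ st, (lyapunov c γ st - γ / 4 * ‖gradient P.objective st.model‖ ^ 2 + B) ∂(μ.map X)) :=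
    MeanLE.prod hcomp (fun p => lyapunov_nonneg hb c hγ.le _) hstep
      ⟨(hi'.sub (hg'.const_mul _)).add (integrable_const B), le_rfl⟩
  have hgap : Measurable fun st : P.State =>
      lyapunov c γ st - γ / 4 * ‖gradient P.objective st.model‖ ^ 2 + B :=
    (hlm.sub (hgm.const_mul _)).add_const B
  have hpair : AEMeasurable (fun ω => (X ω, D t ω)) μ := hXm.prodMk (hD t).aemeasurable
  rw [← hlaw] at hprod
  refine ⟨(integrable_map_measure hcomp.aestronglyMeasurable hpair).1 hprod.1, ?_⟩
  have h2 := hprod.2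
  rw [integral_map hpair hcomp.aestronglyMeasurable, integral_map hXm
    hgap.aestronglyMeasurable] at h2
  have hsub : Integrable (fun ω => lyapunov c γ (X ω) -
      γ / 4 * ‖gradient P.objective (X ω).model‖ ^ 2) μ := hi.sub (hg.const_mul _)
  rw [integral_add hsub (integrable_const B), integral_sub hi (hg.const_mul _),
    integral_const_mul, integral_const, probReal_univ, one_smul] at h2
  exact h2

/-- The drift telescopes. The final Lyapunov value is nonnegative, and the initial one is only the
objective gap because unseen samples carry no error. -/
lemma sum_integral_gradient_le (hn : n ≠ 0) (hN : 1 ≤ N) (hcQ : cQ ^ 2 ≤ 1 / 2)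
    (hb : BddBelow (Set.range P.objective)) {σ : ℝ} (hσ : P.BoundedVariance σ)
    (hind : iIndepFun D μ) (hD : ∀ t, HasLaw (D t) (drawLaw n N ν) μ) {γ : ℝ} (hγ : 0 < γ)
    (hγ' : Lf * γ + c.driftFactor N * γ ^ 2 ≤ 1 / 16) (x₁ : P.Params) (T : ℕ) :
    (∀ t < T, Integrable (fun ω =>
      ‖gradient P.objective (P.run q γ x₁ (fun s => D s ω) t).model‖ ^ 2) μ) ∧
    γ / 4 * ∑ t ∈ Finset.range T, ∫ ω,
      ‖gradient P.objective (P.run q γ x₁ (fun s => D s ω) t).model‖ ^ 2 ∂μ ≤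
      P.objective x₁ - (⨅ x, P.objective x) + T *
        (4 * γ * (Lf * γ + c.driftFactor N * γ ^ 2) * (σ ^ 2 + cQ ^ 2 * c.cTildeSq)) := by
  set B := 4 * γ * (Lf * γ + c.driftFactor N * γ ^ 2) * (σ ^ 2 + cQ ^ 2 * c.cTildeSq) with hB
  -- Integrability of the Lyapunov function is carried through the induction, since each step
  -- requires it of the previous state.
  have key : Integrable (fun ω => lyapunov c γ (P.run q γ x₁ (fun s => D s ω) T)) μ ∧
      (∀ t < T, Integrable (fun ω =>
        ‖gradient P.objective (P.run q γ x₁ (fun s => D s ω) t).model‖ ^ 2) μ) ∧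
      ∫ ω, lyapunov c γ (P.run q γ x₁ (fun s => D s ω) T) ∂μ +
      γ / 4 * ∑ t ∈ Finset.range T, ∫ ω,
        ‖gradient P.objective (P.run q γ x₁ (fun s => D s ω) t).model‖ ^ 2 ∂μ ≤
        P.objective x₁ - (⨅ x, P.objective x) + T * B := by
    induction T with
    | zero =>
      have h : lyapunov c γ (P.initState x₁) = P.objective x₁ - ⨅ x, P.objective x := by
        rw [lyapunov, totalError_initState, mul_zero, add_zero]; rfl
      simp only [run, h]
      simp
    | succ T ih =>
      obtain ⟨h1, h2, h3⟩ := ih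
      obtain ⟨h4, h5, h6⟩ := hP.integral_lyapunov_run_succ hq hn hN hcQ hb hσ hind hD hγ hγ' x₁ T h1
      refine ⟨h5, fun t ht => ?_, ?_⟩
      · rcases Nat.lt_succ_iff_lt_or_eq.1 ht with h | rfl
        · exact h2 t h
        · exact h4
      · rw [Finset.sum_range_succ]
        push_cast
        linarith
  refine ⟨key.2.1, ?_⟩
  have : 0 ≤ ∫ ω, lyapunov c γ (P.run q γ x₁ (fun s => D s ω) T) ∂μ :=
    integral_nonneg fun ω => lyapunov_nonneg hb c hγ.le _
  linarith [key.2.2]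

end Main

end LipschitzAssumptions

end Pipeline

end

/-! ### The convergence theorem -/

theorem theorem2 :
    ∃ (c₀ A : ℝ) (C : (n N : ℕ) → (cQ : ℝ) → PipelineConstants n → ℝ),
      0 < c₀ ∧ 0 < A ∧ (∀ n N cQ c, 0 < C n N cQ c) ∧
      ∀ (n N : ℕ), 2 ≤ n → 1 ≤ N →
      ∀ (P : Pipeline n N) (Lf : ℝ≥0) (c : PipelineConstants n) (σ cQ : ℝ),
        P.LipschitzAssumptions Lf c → P.BoundedVariance σ →
        BddBelow (Set.range P.objective) →
        0 ≤ cQ → cQ < Real.sqrt (1 / 2) →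
      ∀ (S : Type*) [MeasurableSpace S] (ν : Measure S) [IsProbabilityMeasure ν]
        (q : P.Quantizers S), (∀ i, IsUnbiasedQuantizer ν (q i) cQ) →
      ∀ (Ω : Type*) [MeasurableSpace Ω] (μ : Measure Ω) [IsProbabilityMeasure μ]
        (D : ℕ → Ω → Pipeline.Draw n N S),
        iIndepFun D μ → (∀ t, HasLaw (D t) (Pipeline.drawLaw n N ν) μ) →
      ∀ (x₁ : P.Params) (T : ℕ), 1 ≤ T →
      ∀ γ : ℝ, γ = c₀ / ((C n N cQ c + Lf) * Real.sqrt T) →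
        (∀ t < T, Integrable (fun ω =>
          ‖gradient P.objective (P.run q γ x₁ (fun s => D s ω) t).model‖ ^ 2) μ) ∧
        (∑ t ∈ Finset.range T, ∫ ω,
          ‖gradient P.objective (P.run q γ x₁ (fun s => D s ω) t).model‖ ^ 2 ∂μ) / T ≤
          A * ((C n N cQ c + Lf) * (P.objective x₁ - ⨅ x, P.objective x) / Real.sqrt T +
            (σ ^ 2 + cQ ^ 2 * c.cTildeSq) / Real.sqrt T) := by
  -- The contraction is uniform over `cQ ^ 2 ≤ 1 / 2`, so `C` can ignore `cQ`. The summand `1` makes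
  -- `M = C + Lf ≥ 1`. `A` is the `128` in `4 / γ = 128 * M * √T`.
  refine ⟨1 / 32, 128, fun n N _ c => c.driftFactor N + 1, by norm_num, by norm_num,
    fun n N _ c => by have := c.driftFactor_nonneg N; positivity, ?_⟩
  intro n N hn hN P Lf c σ cQ hP hσ hb hcQ0 hcQ S _ ν _ q hq Ω _ μ _ D hind hD x₁ T hT γ hγ
  have hR := c.driftFactor_nonneg N
  set R := c.driftFactor N with hRdef
  have hcQ' : cQ ^ 2 ≤ 1 / 2 := by
    have := pow_le_pow_left₀ hcQ0 hcQ.le 2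
    rwa [Real.sq_sqrt (by norm_num)] at this
  have hL : (0 : ℝ) ≤ Lf := Lf.2
  set M := R + 1 + (Lf : ℝ) with hM
  have hM1 : 1 ≤ M := by linarith
  have hT' : (1 : ℝ) ≤ T := by exact_mod_cast hT
  set r := Real.sqrt T with hr
  have hr1 : 1 ≤ r := Real.one_le_sqrt.2 hT'
  have hrr : r ^ 2 = T := Real.sq_sqrt (by linarith)
  have hγ0 : 0 < γ := by rw [hγ]; positivity
  have hMγ : M * γ = 1 / 32 / r := by rw [hγ]; field_simp
  -- Both terms are at most `M * γ = 1 / (32 * √T)`: the first since `Lf ≤ M`, the second since `R ≤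
  -- M ^ 2` and `M * γ ≤ 1`.
  have hrate : Lf * γ + R * γ ^ 2 ≤ 1 / 16 / r := by
    have h1 : Lf * γ ≤ M * γ := by gcongr; linarith
    have h2 : R * γ ^ 2 ≤ (M * γ) ^ 2 := by
      rw [mul_pow]
      gcongr
      nlinarith
    have h3 : (M * γ) ^ 2 ≤ M * γ := by
      rw [sq]
      refine mul_le_of_le_one_left (by positivity) ?_
      rw [hMγ, div_le_one (by positivity)]
      linarith
    have h4 : 1 / 16 / r = 2 * (M * γ) := by rw [hMγ]; ring
    linarith
  have hrate' : Lf * γ + R * γ ^ 2 ≤ 1 / 16 :=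
    hrate.trans (div_le_self (by norm_num) hr1)
  obtain ⟨h1, h2⟩ := hP.sum_integral_gradient_le hq (by omega) hN hcQ' hb hσ hind hD hγ0 hrate' x₁ T
  refine ⟨h1, ?_⟩
  have hs : 0 ≤ σ ^ 2 + cQ ^ 2 * c.cTildeSq := by
    have : 0 ≤ c.cTildeSq := Finset.sum_nonneg fun i _ => by positivity
    positivity
  set s := σ ^ 2 + cQ ^ 2 * c.cTildeSq with hsdef
  set Δ := P.objective x₁ - ⨅ x, P.objective x with hΔ
  set G := ∑ t ∈ Finset.range T, ∫ ω,
    ‖gradient P.objective (P.run q γ x₁ (fun s => D s ω) t).model‖ ^ 2 ∂μ with hG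
  have h3 : γ / 4 * G ≤ Δ + T * (4 * γ * (1 / 16 / r) * s) := by
    refine h2.trans ?_
    gcongr
  have h4 : G ≤ 4 / γ * (Δ + T * (4 * γ * (1 / 16 / r) * s)) := by
    have := mul_le_mul_of_nonneg_left h3 (show 0 ≤ 4 / γ by positivity)
    have e : 4 / γ * (γ / 4 * G) = G := by field_simp
    rwa [e] at this
  have h5 : 4 / γ * (Δ + T * (4 * γ * (1 / 16 / r) * s)) / T = 128 * (M * Δ / r) + s / r := by
    have e1 : 4 / γ = 128 * M * r := by rw [hγ]; field_simp; norm_num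
    have e2 : 4 / γ * (Δ + T * (4 * γ * (1 / 16 / r) * s)) = 4 / γ * Δ + T * (s / r) := by
      field_simp
      ring
    rw [e2, e1, ← hrr]
    field_simp
  calc G / T ≤ _ := div_le_div_of_nonneg_right h4 (by linarith)
    _ = 128 * (M * Δ / r) + s / r := h5
    _ ≤ 128 * (M * Δ / r + s / r) := by
      have : 0 ≤ s / r := by positivity
      linarith
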